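/- Let $\mathbb T$ be the unit circle with normalized Lebesgue measure, let $H^2(\mathbb T)\subset L^2(\mathbb T)$ be the closed linear span of $1,\mu,\mu^2,\dots$, let $P_+:L^2(\mathbb T)\to H^2(\mathbb T)$ be the orthogonal projection, and let $(Wf)(\mu)=f(\bar\mu)$. For $\omega\in L^\infty(\mathbb T)$ let $H(\omega)$ be the Hankel operator on $H^2(\mathbb T)$ defined by $H(\omega)f=P_+(\omega Wf)$. For a compact operator $T$ let $s_1(T)\ge s_2(T)\ge\dots$ be its singular values, that is, the eigenvalues of $|T|=\sqrt{T^*T}$ enumerated in non-increasing order with multiplicities (and continued by $0$ if there are only finitely many positive ones). For a bounded operator $T$ that is not compact, $s_n(T)$ is understood in the sense of the min-max principle: it is the infimum of all $\varepsilon\ge0$ such that the spectrum of $|T|$ in $(\varepsilon,\infty)$ consists of finitely many eigenvalues whose total multiplicity is less than $n$. The singular support $\operatorname{sing\,supp}\omega$ of $\omega\in L^\infty(\mathbb T)$ is the smallest closed set $X\subset\mathbb T$ such that $\omega\in C^\infty(\mathbb T\setminus X)$ (after a change of $\omega$ on a null set). **Theorem.** Let $\omega_1,\dots,\omega_L\in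 L^\infty(\mathbb T)$ be such that $$\operatorname{sing\,supp}\omega_\ell\cap\operatorname{sing\,supp}\omega_j=\varnothing,\qquad \ell\ne j,$$ and put $\omega=\omega_1+\dots+\omega_L$. Then for every $p>0$, with upper and lower limits in $[0,\infty]$, $$\limsup_{n\to\infty} n\,s_n(H(\omega))^p\le\sum_{\ell=1}^L\limsup_{n\to\infty} n\,s_n(H(\omega_\ell))^p,$$ $$\liminf_{n\to\infty} n\,s_n(H(\omega))^p\ge\sum_{\ell=1}^L\liminf_{n\to\infty} n\,s_n(H(\omega_\ell))^p.$$ In particular, if for each $\ell$ the limit $\lim_{n\to\infty} n\,s_n(H(\omega_\ell))^p$ exists in $[0,\infty]$, then the limit of $n\,s_n(H(\omega))^p$ exists and $$\lim_{n\to\infty} n\,s_n(H(\omega))^p=\sum_{\ell=1}^L\lim_{n\to\infty} n\,s_n(H(\omega_\ell))^p.$$ -/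

import Mathlib

open MeasureTheory Filter Topology
open scoped ENNReal

noncomputable section

namespace HankelLocalization

/-- The unit circle `𝕋`, parametrized by `θ ↦ μ = exp (2πiθ)` with `θ ∈ ℝ/ℤ`. -/
abbrev Torus : Type := UnitAddCircle

/-- The normalized Lebesgue measure on the circle. -/
abbrev m : Measure Torus := AddCircle.haarAddCircle

/-- `L²(𝕋)`. -/
abbrev L2 : Type := Lp ℂ 2 m

/-- `L^∞(𝕋)`, the space of symbols. -/
abbrev LInfty : Type := Lp ℂ ∞ m

/-- The Hardy space `H²(𝕋)`: the closed linear span in `L²(𝕋)` of `1, μ, μ², …`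
(`fourierLp 2 n` is the class of `μ ^ n`). -/
def hardySubspace : Submodule ℂ L2 :=
  (Submodule.span ℂ (Set.range fun n : ℕ => (fourierLp 2 (n : ℤ) : L2))).topologicalClosure

/-- The Hardy space as a Hilbert space in its own right. -/
abbrev H2 : Type := hardySubspace

instance : CompleteSpace hardySubspace :=
  (Submodule.isClosed_topologicalClosure _).completeSpace_coe

/-- The involution `(W f)(μ) = f(μ̄)` on `L²(𝕋)`; complex conjugation of `μ` is `θ ↦ -θ`. -/
def reflection : L2 →L[ℂ] L2 :=
  (Lp.compMeasurePreservingₗᵢ ℂ (fun θ : Torus => -θ)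
    (Measure.measurePreserving_neg m)).toContinuousLinearMap

/-- Multiplication by a bounded symbol on `L²(𝕋)`. -/
def mulOp (ω : LInfty) : L2 →L[ℂ] L2 :=
  (ContinuousLinearMap.mul ℂ ℂ).holderL m ∞ 2 2 ω

/-- The Hankel operator `H(ω) f = P₊ (ω W f)` on `H²(𝕋)`. -/
def hankel (ω : LInfty) : H2 →L[ℂ] H2 :=
  hardySubspace.orthogonalProjectionOnto ∘L mulOp ω ∘L reflection ∘L hardySubspace.subtypeL

/-- `ω ∈ C^∞(𝕋 ∖ X)`: off `X`, the class `ω` has a representative that is smooth at every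
point. -/
def IsSmoothOff (ω : LInfty) (X : Set Torus) : Prop :=
  ∃ g : Torus → ℂ, (∀ᵐ θ ∂m, θ ∉ X → ω θ = g θ) ∧
    ∀ t : ℝ, (t : Torus) ∉ X → ContDiffAt ℝ (⊤ : ℕ∞) (fun s : ℝ => g (s : Torus)) t

/-- The singular support of `ω`: the smallest closed set `X` such that `ω ∈ C^∞(𝕋 ∖ X)`. -/
def singSupp (ω : LInfty) : Set Torus :=
  ⋂₀ {X : Set Torus | IsClosed X ∧ IsSmoothOff ω X}

section SingularValues

variable {E : Type*} [NormedAddCommGroup E] [InnerProductSpace ℂ E] [CompleteSpace E]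

/-- The span of all eigenvectors of `A` with real eigenvalue larger than `ε`; its dimension is the
number of these eigenvalues, counted with multiplicities. -/
def eigenspaceAbove (A : E →L[ℂ] E) (ε : ℝ) : Submodule ℂ E :=
  ⨆ t ∈ Set.Ioi ε, Module.End.eigenspace (A : E →ₗ[ℂ] E) (t : ℂ)

/-- `λ_n(A)` for a positive operator `A` and `n ≥ 1`: the least `ε ≥ 0` above which `A` has fewer
than `n` eigenvalues, counted with multiplicities.

If `A` is compact, its spectrum above any `ε > 0` is finite, and this is the `n`-th term of the
non-increasing sequence of eigenvalues of `A` (continued by `0` if `A` has fewer than `n` positive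
eigenvalues). For `A` that is not compact, the requirement on the spectrum yields the usual
convention of the min-max principle: `λ_n(A)` is the `n`-th eigenvalue above the essential spectrum,
or the top of the essential spectrum if there are fewer than `n` such eigenvalues. -/
def nthEigenvalue (A : E →L[ℂ] E) (n : ℕ) : ℝ :=
  sInf {ε : ℝ | 0 ≤ ε ∧ (spectrum ℝ A ∩ Set.Ioi ε).Finite ∧
    Module.rank ℂ (eigenspaceAbove A ε) < n}

/-- The singular values `s_n(T) = λ_n(|T|)`, `|T| = √(T* T)`, `n = 1, 2, …`. -/
def singularValue (T : E →L[ℂ] E) (n : ℕ) : ℝ :=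
  nthEigenvalue (CFC.abs T) n

/-- The sequence `n s_n(T)^p`, with values in `[0, ∞]` so that its upper and lower limits are
allowed to be infinite. -/
def scaledSingularValue (p : ℝ) (T : E →L[ℂ] E) (n : ℕ) : ℝ≥0∞ :=
  ENNReal.ofReal (n * singularValue T n ^ p)

end SingularValues

end HankelLocalization

end

/-! The Hankel operators `A l = hankel (ω l)` are asymptotically orthogonal: for `j ≠ l` the
singular values of `(A j)* A l` and `A j (A l)*` decay faster than any power (`Rapid`). Up to such
errors the sum behaves like the direct sum of the `A l`, whose singular value counting function is
the sum of the individual ones.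

Rapid decay starts from the commutator of the Riesz projection `P` with a smooth multiplier `g`. It
vanishes off frequencies at most `k` if `g` is a trigonometric polynomial of degree `k`, and smooth
`g` are approximated by these faster than any power of `k` (`rapid_rieszComm`). As `P W P` has rank
one, Hankel operators with smooth symbol are rapid. A smooth cutoff `φ`, equal to `1` near one
singular support and `0` near the other, can then be moved through `P` between the two factors. What
remains contains a commutator or a smooth symbol (`rapid_hankel_of_disjoint`).

The abstract part works with the number `N(ε)` of singular values above `ε`, in variational form:
`‖T x‖ ≤ ε ‖x‖` off a subspace of that dimension. This also covers noncompact operators, where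
`N(ε)` may be infinite, and `n s_n^p` and `ε^p N(ε)` have the same upper and lower limits. For the
row operator `R f = ∑ A l (f l)`, the form `‖R f‖²` differs from that of the direct sum by terms
with `(A j)* A l`, while `R R*` differs from `(∑ A l)(∑ A l)*` by terms with `A j (A l)*`. Passing
between `R` and `R*` preserves the bounds, so both comparisons combine (`formLE_sum`,
`sum_le_of_formLE_sum`). The cost is a factor `a > 1` in `ε` and `o(ε^(-p))` in the count. Finally
`a` tends to `1`. -/

noncomputable section

namespace HankelLocalization

/-! ### Variational counting for quadratic forms -/

section CountingSubspaces

variable {E G : Type*} [NormedAddCommGroup E] [InnerProductSpace ℂ E]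
  [NormedAddCommGroup G] [InnerProductSpace ℂ G]

/-- The form `q` is at most `c ‖x‖²` on the orthogonal complement of a subspace of dimension at
most `k`. -/
def FormLE (q : E → ℝ) (c : ℝ) (k : ℕ) : Prop :=
  ∃ F : Submodule ℂ E, FiniteDimensional ℂ F ∧ Module.finrank ℂ F ≤ k ∧
    ∀ x ∈ Fᗮ, q x ≤ c * ‖x‖ ^ 2

/-- The form `q` is larger than `c ‖x‖²` on a subspace of dimension `n`. -/
def FormGT (q : E → ℝ) (c : ℝ) (n : ℕ) : Prop :=
  ∃ V : Submodule ℂ E, FiniteDimensional ℂ V ∧ Module.finrank ℂ V = n ∧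
    ∀ x ∈ V, x ≠ 0 → c * ‖x‖ ^ 2 < q x

lemma exists_ne_zero_mem_orthogonal (F V : Submodule ℂ E) [FiniteDimensional ℂ F]
    [FiniteDimensional ℂ V] (h : Module.finrank ℂ F < Module.finrank ℂ V) :
    ∃ x ∈ V, x ≠ 0 ∧ x ∈ Fᗮ := by
  obtain ⟨y, hy, hy0⟩ := Submodule.exists_mem_ne_zero_of_ne_bot
    (LinearMap.ker_ne_bot_of_finrank_lt
      (f := (F.orthogonalProjectionOnto : E →ₗ[ℂ] F) ∘ₗ V.subtype) h)
  refine ⟨y, y.2, by simpa using hy0, ?_⟩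
  have : F.orthogonalProjectionOnto (y : E) = 0 := by simpa using hy
  simpa using this

/-- If `n > k`, the larger subspace meets the orthogonal complement of the smaller one in a nonzero
vector, where the two bounds contradict each other. -/
lemma FormGT.le {q : E → ℝ} {c : ℝ} {n k : ℕ} (hV : FormGT q c n) (hF : FormLE q c k) :
    n ≤ k := by
  obtain ⟨V, hVf, hVn, hV⟩ := hV
  obtain ⟨F, hFf, hFk, hF⟩ := hF
  by_contra! h
  obtain ⟨x, hxV, hx0, hxF⟩ := exists_ne_zero_mem_orthogonal F V (by omega)
  exact absurd (hF x hxF) (not_le.2 (hV x hxV hx0))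

lemma FormLE.mono {q : E → ℝ} {c c' : ℝ} {k k' : ℕ} (h : FormLE q c k) (hc : c ≤ c')
    (hk : k ≤ k') : FormLE q c' k' := by
  obtain ⟨F, hF, hFk, hq⟩ := h
  exact ⟨F, hF, hFk.trans hk, fun x hx => (hq x hx).trans (by gcongr)⟩

lemma FormLE.add {q₁ q₂ q : E → ℝ} {c₁ c₂ : ℝ} {k₁ k₂ : ℕ} (h₁ : FormLE q₁ c₁ k₁)
    (h₂ : FormLE q₂ c₂ k₂) (hq : ∀ x, q x ≤ q₁ x + q₂ x) : FormLE q (c₁ + c₂) (k₁ + k₂) := by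
  obtain ⟨F₁, hF₁, hk₁, hq₁⟩ := h₁
  obtain ⟨F₂, hF₂, hk₂, hq₂⟩ := h₂
  refine ⟨F₁ ⊔ F₂, inferInstance, (Submodule.finrank_add_le_finrank_add_finrank _ _).trans
    (add_le_add hk₁ hk₂), fun x hx => ?_⟩
  rw [← Submodule.inf_orthogonal] at hx
  linarith [hq x, hq₁ x hx.1, hq₂ x hx.2]

/-- Passage to the adjoint preserves the bound. -/
lemma FormLE.adjoint {S : E →ₗ[ℂ] G} {R : G → E} (hSR : ∀ x y, inner ℂ (S x) y = inner ℂ x (R y))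
    {c : ℝ} (hc : 0 ≤ c) {k : ℕ} (h : FormLE (fun x => ‖S x‖ ^ 2) c k) :
    FormLE (fun y => ‖R y‖ ^ 2) c k := by
  obtain ⟨F, hF, hFk, hS⟩ := h
  -- If `y` is orthogonal to `S F`, then `R y` is orthogonal to `F`, so the bound on `S` applies to
  -- `R y`. Then `‖R y‖² = ⟪S R y, y⟫` gives `‖R y‖⁴ ≤ c ‖R y‖² ‖y‖²`.
  refine ⟨F.map S, inferInstance, (Submodule.finrank_map_le S F).trans hFk, fun y hy => ?_⟩
  have hRy : R y ∈ Fᗮ := by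
    rw [Submodule.mem_orthogonal] at hy ⊢
    intro u hu
    rw [← hSR]
    exact hy _ (Submodule.mem_map_of_mem hu)
  have h1 : ‖R y‖ ^ 2 ≤ ‖S (R y)‖ * ‖y‖ := by
    have : ‖R y‖ ^ 2 = ‖inner ℂ (S (R y)) y‖ := by
      rw [hSR, inner_self_eq_norm_sq_to_K]; simp
    rw [this]; exact norm_inner_le_norm _ _
  have h2 := hS _ hRy
  by_cases h0 : R y = 0
  · simp only [h0, norm_zero]
    rw [zero_pow two_ne_zero]
    positivity
  · have hpos : 0 < ‖R y‖ := norm_pos_iff.2 h0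
    have h3 : (‖R y‖ ^ 2) ^ 2 ≤ (c * ‖R y‖ ^ 2) * ‖y‖ ^ 2 := by
      calc (‖R y‖ ^ 2) ^ 2 ≤ (‖S (R y)‖ * ‖y‖) ^ 2 := by gcongr
        _ = ‖S (R y)‖ ^ 2 * ‖y‖ ^ 2 := by ring
        _ ≤ _ := by gcongr
    have : ‖R y‖ ^ 2 * ‖R y‖ ^ 2 ≤ ‖R y‖ ^ 2 * (c * ‖y‖ ^ 2) := by nlinarith
    exact le_of_mul_le_mul_left this (by positivity)

lemma norm_sum_sq_of_orthogonal {ι : Type*} (s : Finset ι) (u : ι → E)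
    (h : ∀ i ∈ s, ∀ j ∈ s, i ≠ j → inner ℂ (u i) (u j) = 0) :
    ‖∑ i ∈ s, u i‖ ^ 2 = ∑ i ∈ s, ‖u i‖ ^ 2 := by
  classical
  induction s using Finset.induction_on with
  | empty => simp
  | insert a s ha ih =>
    rw [Finset.sum_insert ha, Finset.sum_insert ha, ← ih fun i hi j hj =>
      h i (Finset.mem_insert_of_mem hi) j (Finset.mem_insert_of_mem hj), sq, sq, sq]
    refine norm_add_sq_eq_norm_sq_add_norm_sq_of_inner_eq_zero (𝕜 := ℂ) _ _ ?_
    rw [inner_sum]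
    exact Finset.sum_eq_zero fun i hi => h a (Finset.mem_insert_self _ _) i
      (Finset.mem_insert_of_mem hi) (by rintro rfl; exact ha hi)

/-- If `A` stretches each of finitely many pairwise orthogonal vectors by more than `ε`, and their
images are pairwise orthogonal, then it stretches their nonzero combinations by more than `ε`. -/
lemma norm_sum_lt_of_orthogonal {ι : Type*} (s : Finset ι) (A : E →ₗ[ℂ] G) {ε : ℝ} (hε : 0 ≤ ε)
    (u : ι → E) (h : ∀ i ∈ s, ∀ j ∈ s, i ≠ j → inner ℂ (u i) (u j) = 0)
    (hA : ∀ i ∈ s, ∀ j ∈ s, i ≠ j → inner ℂ (A (u i)) (A (u j)) = 0)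
    (hlt : ∀ i ∈ s, u i ≠ 0 → ε * ‖u i‖ < ‖A (u i)‖) (h0 : ∑ i ∈ s, u i ≠ 0) :
    ε ^ 2 * ‖∑ i ∈ s, u i‖ ^ 2 < ‖A (∑ i ∈ s, u i)‖ ^ 2 := by
  rw [map_sum, norm_sum_sq_of_orthogonal s u h, norm_sum_sq_of_orthogonal s _ hA, Finset.mul_sum]
  have key : ∀ i ∈ s, u i ≠ 0 → ε ^ 2 * ‖u i‖ ^ 2 < ‖A (u i)‖ ^ 2 := fun i hi hi0 => by
    rw [← mul_pow]
    exact pow_lt_pow_left₀ (hlt i hi hi0) (by positivity) two_ne_zero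
  refine Finset.sum_lt_sum (fun i hi => ?_) ?_
  · by_cases hi0 : u i = 0
    · simp [hi0]
    · exact (key i hi hi0).le
  · obtain ⟨i, hi, hi0⟩ := Finset.exists_ne_zero_of_sum_ne_zero h0
    exact ⟨i, hi, key i hi hi0⟩

end CountingSubspaces

/-! ### From the spectrum of `|T|` to variational bounds -/

section Spectral

variable {E : Type*} [NormedAddCommGroup E] [InnerProductSpace ℂ E] [CompleteSpace E]

/-- The piecewise linear bump of height one at `t` and half-width `r`. -/
def tent (t r x : ℝ) : ℝ := max 0 (1 - |x - t| / r)

lemma continuous_tent (t r : ℝ) : Continuous (tent t r) := by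
  unfold tent; fun_prop

lemma tent_self (t r : ℝ) : tent t r t = 1 := by simp [tent]

lemma tent_eq_zero {t r x : ℝ} (hr : 0 < r) (h : r ≤ |x - t|) : tent t r x = 0 := by
  have : 1 ≤ |x - t| / r := (one_le_div hr).2 h
  exact max_eq_left (by linarith)

lemma inner_cfc_left {A : E →L[ℂ] E} (f : ℝ → ℝ) (x y : E) :
    inner ℂ (cfc f A x) y = inner ℂ x (cfc f A y) := by
  have h : IsSelfAdjoint (cfc f A) := cfc_predicate f A
  exact (ContinuousLinearMap.isSelfAdjoint_iff_isSymmetric.1 h) x y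

lemma norm_abs_apply (T : E →L[ℂ] E) (x : E) : ‖CFC.abs T x‖ = ‖T x‖ := by
  have hs : IsSelfAdjoint (CFC.abs T) := (CFC.abs_nonneg T).isSelfAdjoint
  have h1 : inner ℂ (CFC.abs T x) (CFC.abs T x) = inner ℂ (T x) (T x) := by
    refine ((ContinuousLinearMap.isSelfAdjoint_iff_isSymmetric.1 hs) x (CFC.abs T x)).trans ?_
    have := congrArg (fun B : E →L[ℂ] E => inner ℂ x (B x)) (CFC.abs_mul_abs T)
    simpa [ContinuousLinearMap.star_eq_adjoint, ContinuousLinearMap.adjoint_inner_right] using this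
  rw [inner_self_eq_norm_sq_to_K, inner_self_eq_norm_sq_to_K] at h1
  have h2 : ‖CFC.abs T x‖ ^ 2 = ‖T x‖ ^ 2 := by exact_mod_cast h1
  exact (pow_left_inj₀ (norm_nonneg _) (norm_nonneg _) two_ne_zero).1 h2

lemma exists_isolating_radius {s : Set ℝ} {ε : ℝ} (hs : (s ∩ Set.Ioi ε).Finite) {t : ℝ}
    (ht : ε < t) : ∃ r > 0, ∀ x ∈ s, x ≠ t → r ≤ |x - t| := by
  have hcl : IsClosed (((s ∩ Set.Ioi ε) \ {t}) ∪ Set.Iic ε) :=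
    (hs.subset Set.sdiff_subset).isClosed.union isClosed_Iic
  have hmem : t ∈ (((s ∩ Set.Ioi ε) \ {t}) ∪ Set.Iic ε)ᶜ := by simp [ht]
  obtain ⟨r, hr, hball⟩ := Metric.isOpen_iff.1 hcl.isOpen_compl t hmem
  refine ⟨r, hr, fun x hx hxt => ?_⟩
  by_contra! hlt
  have := hball (show x ∈ Metric.ball t r by simpa [Real.dist_eq] using hlt)
  simp only [Set.mem_compl_iff, Set.mem_union, Set.mem_sdiff, Set.mem_inter_iff, Set.mem_Ioi,
    Set.mem_singleton_iff, Set.mem_Iic, not_or, not_and, not_le] at this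
  exact this.1 ⟨hx, this.2⟩ hxt

/-- On the spectrum, a tent isolating a point `t > ε` is the indicator of `{t}`. Its functional
calculus therefore maps into the `t`-eigenspace and, being self-adjoint, kills `x`. -/
lemma norm_apply_le_of_mem_orthogonal {A : E →L[ℂ] E} (hA : 0 ≤ A) {ε : ℝ} (hε : 0 ≤ ε)
    (hfin : (spectrum ℝ A ∩ Set.Ioi ε).Finite) {x : E} (hx : x ∈ (eigenspaceAbove A ε)ᗮ) :
    ‖A x‖ ≤ ε * ‖x‖ := by
  have hsa : IsSelfAdjoint A := hA.isSelfAdjoint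
  have hr : ∀ t : ℝ, ∃ r > 0, ε < t → ∀ x ∈ spectrum ℝ A, x ≠ t → r ≤ |x - t| := fun t => by
    by_cases ht : ε < t
    · obtain ⟨r, hr, h⟩ := exists_isolating_radius hfin ht
      exact ⟨r, hr, fun _ => h⟩
    · exact ⟨1, one_pos, fun h => absurd h ht⟩
  choose r hr0 hr using hr
  have htent : ∀ t, ε < t → ∀ y ∈ spectrum ℝ A, y ≠ t → tent t (r t) y = 0 :=
    fun t ht y hy hyt => tent_eq_zero (hr0 t) (hr t ht y hy hyt)
  have hker : ∀ t, ε < t → cfc (tent t (r t)) A x = 0 := fun t ht => by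
    set B := cfc (tent t (r t)) A with hB
    have hAB : A * B = (t : ℂ) • B := by
      have h1 : A * B = cfc (fun y => y * tent t (r t) y) A := by
        rw [cfc_mul (fun y => y) (tent t (r t)) A (by fun_prop)
          (continuous_tent _ _).continuousOn, cfc_id' ℝ A]
      have h2 : (t : ℂ) • B = cfc (fun y => t * tent t (r t) y) A := by
        rw [cfc_const_mul t (tent t (r t)) A (continuous_tent _ _).continuousOn]
        ext z; simp [hB]
      rw [h1, h2]
      refine cfc_congr fun y hy => ?_
      by_cases hyt : y = t
      · simp [hyt]
      · simp [htent t ht y hy hyt]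
    have hmem : ∀ z, B z ∈ eigenspaceAbove A ε := fun z => by
      refine Submodule.mem_iSup_of_mem t (Submodule.mem_iSup_of_mem ht ?_)
      rw [Module.End.mem_eigenspace_iff]
      simpa using congrArg (fun C : E →L[ℂ] E => C z) hAB
    rw [← inner_self_eq_zero (𝕜 := ℂ), inner_cfc_left]
    exact Submodule.inner_left_of_mem_orthogonal (hmem _) hx
  set s := hfin.toFinset
  have hs : ∀ t ∈ s, ε < t := fun t ht => by simp [s] at ht; exact ht.2
  -- On the spectrum `g` is the identity up to `ε` and zero above it, hence `‖g(A)‖ ≤ ε`; on `x` the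
  -- operators `g(A)` and `A` agree.
  set g : ℝ → ℝ := fun y => y * (1 - ∑ t ∈ s, tent t (r t) y) with hg
  have hcont : ∀ t ∈ s, ContinuousOn (tent t (r t)) (spectrum ℝ A) :=
    fun t _ => (continuous_tent _ _).continuousOn
  have hcs : ContinuousOn (fun y => ∑ t ∈ s, tent t (r t) y) (spectrum ℝ A) :=
    continuousOn_finsetSum _ hcont
  have hsum : cfc (fun y => ∑ t ∈ s, tent t (r t) y) A x = 0 := by
    have := cfc_sum (fun t => tent t (r t)) A s hcont
    rw [show (fun y => ∑ t ∈ s, tent t (r t) y) = ∑ t ∈ s, tent t (r t) by ext; simp, this]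
    simp only [sum_apply]
    exact Finset.sum_eq_zero fun t ht => hker t (hs t ht)
  have hAx : A x = cfc g A x := by
    rw [hg, cfc_mul (fun y => y) (fun y => 1 - ∑ t ∈ s, tent t (r t) y) A (by fun_prop)
      (continuousOn_const.sub hcs), cfc_id' ℝ A, cfc_sub _ _ A continuousOn_const hcs,
      cfc_const_one ℝ A]
    simp [hsum]
  rw [hAx]
  refine (cfc g A).le_of_opNorm_le (norm_cfc_le hε fun y hy => ?_) x
  have hy0 : 0 ≤ y := spectrum_nonneg_of_nonneg hA hy
  by_cases hyε : ε < y
  · have hys : y ∈ s := by simp [s, hy, hyε]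
    have : ∑ t ∈ s, tent t (r t) y = 1 := by
      rw [Finset.sum_eq_single y (fun t ht hty => htent t (hs t ht) y hy hty.symm)
        (fun h => absurd hys h), tent_self]
    simp [hg, this, hε]
  · have : ∑ t ∈ s, tent t (r t) y = 0 := Finset.sum_eq_zero fun t ht =>
      htent t (hs t ht) y hy (by rintro rfl; exact hyε (hs _ ht))
    simp only [hg, this, sub_zero, mul_one, Real.norm_eq_abs, abs_of_nonneg hy0]
    exact not_lt.1 hyε

/-- Tents with disjoint supports above `ε`, centred at `n` spectral points, act as approximate
spectral projections: their ranges are nonzero, mutually orthogonal, remain so under `A`, and are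
stretched by more than `ε`. -/
lemma formGT_of_infinite_spectrum {A : E →L[ℂ] E} (hA : 0 ≤ A) {ε : ℝ} (hε : 0 ≤ ε)
    (hinf : (spectrum ℝ A ∩ Set.Ioi ε).Infinite) (n : ℕ) :
    FormGT (fun x => ‖A x‖ ^ 2) (ε ^ 2) n := by
  have hsa : IsSelfAdjoint A := hA.isSelfAdjoint
  obtain ⟨s, hs, hcard⟩ := hinf.exists_subset_card_eq n
  -- The half-width `r` keeps every tent strictly above `ε` and the tents pairwise disjoint.
  have hev : ∀ᶠ r : ℝ in 𝓝[>] 0, ∀ t ∈ s, ε + r < t ∧ ∀ t' ∈ s, t ≠ t' → 2 * r < |t - t'| := by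
    refine s.eventually_all.2 fun t ht => .and ?_ (s.eventually_all.2 fun t' ht' => ?_)
    · have : ε + 0 < t := by simpa using (hs ht).2
      exact nhdsWithin_le_nhds (ContinuousAt.eventually_lt (by fun_prop) (by fun_prop) this)
    · by_cases htt : t = t'
      · simp [htt]
      · have : 2 * (0 : ℝ) < |t - t'| := by simpa [sub_eq_zero] using htt
        filter_upwards [nhdsWithin_le_nhds
          (ContinuousAt.eventually_lt (f := fun r : ℝ => 2 * r) (g := fun _ => |t - t'|)
            (by fun_prop) (by fun_prop) this)] with r hr _ using hr
  obtain ⟨r, hr, hr0⟩ := (hev.and self_mem_nhdsWithin).exists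
  replace hr0 : 0 < r := hr0
  have hc : ∀ t, ContinuousOn (tent t r) (spectrum ℝ A) := fun t =>
    (continuous_tent _ _).continuousOn
  have hx : ∀ t : s, ∃ y, cfc (tent t r) A y ≠ 0 := fun t => by
    by_contra! h
    have h0 : cfc (tent t r) A = cfc (fun _ => (0 : ℝ)) A := by
      rw [cfc_const_zero]; ext y; simpa using h y
    have := (cfc_eq_cfc_iff_eqOn (hf := hc t)).1 h0 (hs t.2).1
    simp [tent_self] at this
  choose y hy using hx
  set u : s → E := fun t => cfc (tent t r) A (y t) with hu
  have hdisj : ∀ t t' : s, t ≠ t' → ∀ z, tent t r z * tent t' r z = 0 := fun t t' htt z => by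
    by_cases hz : r ≤ |z - t|
    · rw [tent_eq_zero hr0 hz, zero_mul]
    · rw [tent_eq_zero (t := t') hr0, mul_zero]
      have h1 := (hr t t.2).2 t' t'.2 (fun h => htt (Subtype.ext h))
      have h2 := abs_sub_le (t : ℝ) z t'
      rw [abs_sub_comm (t : ℝ) z] at h2
      linarith
  have hmul : ∀ t t' : s, t ≠ t' → ∀ z, cfc (tent t r) A (cfc (tent t' r) A z) = 0 :=
    fun t t' htt z => by
      have h1 := cfc_mul (tent t r) (tent t' r) A (hc _) (hc _)
      rw [show (fun z => tent t r z * tent t' r z) = fun _ => 0 from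
        funext (hdisj t t' htt), cfc_const_zero] at h1
      simpa using (congrArg (fun C : E →L[ℂ] E => C z) h1).symm
  have hcomm : ∀ t : s, ∀ z, A (cfc (tent t r) A z) = cfc (tent t r) A (A z) := fun t z => by
    have h := cfc_commute_cfc (fun x => x) (tent t r) A
    rw [cfc_id' ℝ A] at h
    simpa using congrArg (fun C : E →L[ℂ] E => C z) h.eq
  have hux : ∀ t t' : s, t ≠ t' → inner ℂ (u t) (u t') = 0 := fun t t' htt => by
    rw [hu]; simp only; rw [inner_cfc_left, hmul t t' htt, inner_zero_right]
  have hAux : ∀ t t' : s, t ≠ t' → inner ℂ (A (u t)) (A (u t')) = 0 := fun t t' htt => by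
    rw [hu]; simp only; rw [hcomm, hcomm, inner_cfc_left, hmul t t' htt, inner_zero_right]
  have hlt : ∀ t : s, ∀ z, cfc (tent t r) A z ≠ 0 →
      ε * ‖cfc (tent t r) A z‖ < ‖A (cfc (tent t r) A z)‖ := fun t z hz => by
    set c : ℝ := t - r with hc'
    have hεc : ε < c := by have := (hr t t.2).1; linarith
    have hc0 : 0 < c := hε.trans_lt hεc
    -- A continuous substitute for `1 / x`, exact on the support of the tent and bounded by `1 / c`;
    -- it inverts `A` on the range of the tent operator.
    have hinv : Continuous fun x : ℝ => (max x c)⁻¹ :=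
      (continuous_id.max continuous_const).inv₀ fun x => (hc0.trans_le (le_max_right _ _)).ne'
    have h1 : cfc (fun x => (max x c)⁻¹) A * (A * cfc (tent t r) A) = cfc (tent t r) A := by
      conv_lhs => rw [← cfc_id' ℝ A, cfc_id' ℝ A]
      conv_lhs =>
        enter [2, 1]
        rw [← cfc_id' ℝ A]
      rw [← cfc_mul (fun x => x) (tent t r) A (by fun_prop) (hc t),
        ← cfc_mul _ _ A hinv.continuousOn (by have := continuous_tent t r; fun_prop)]
      refine cfc_congr fun x _ => ?_
      by_cases hx : c ≤ x
      · have : x ≠ 0 := (hc0.trans_le hx).ne'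
        simp only [max_eq_left hx]; field_simp
      · rw [tent_eq_zero hr0]
        · simp
        · have : x < t - r := not_le.1 hx
          rw [abs_sub_comm, abs_of_nonneg (by linarith)]; linarith
    have h2 : ‖cfc (fun x => (max x c)⁻¹) A‖ ≤ c⁻¹ := norm_cfc_le (by positivity) fun x _ => by
      have : 0 < max x c := hc0.trans_le (le_max_right _ _)
      rw [Real.norm_eq_abs, abs_of_pos (by positivity)]
      exact inv_anti₀ hc0 (le_max_right _ _)
    have h3 := (cfc (fun x => (max x c)⁻¹) A).le_of_opNorm_le h2 (A (cfc (tent t r) A z))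
    have h4 : cfc (fun x => (max x c)⁻¹) A (A (cfc (tent t r) A z)) = cfc (tent t r) A z := by
      simpa using congrArg (fun C : E →L[ℂ] E => C z) h1
    rw [h4, ← div_eq_inv_mul, le_div_iff₀' hc0] at h3
    exact (mul_lt_mul_of_pos_right hεc (norm_pos_iff.2 hz)).trans_le h3
  have hli : LinearIndependent ℂ u :=
    linearIndependent_of_ne_zero_of_inner_eq_zero hy fun t t' htt => hux t t' htt
  refine ⟨Submodule.span ℂ (Set.range u),
    FiniteDimensional.span_of_finite ℂ (Set.finite_range _), ?_, fun x hx hx0 => ?_⟩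
  · rw [finrank_span_eq_card hli]; simpa using hcard
  · obtain ⟨c, rfl⟩ := (Submodule.mem_span_range_iff_exists_fun ℂ).1 hx
    refine norm_sum_lt_of_orthogonal Finset.univ (A : E →ₗ[ℂ] E) hε (fun t => c t • u t)
      (fun i _ j _ hij => ?_) (fun i _ j _ hij => ?_) (fun i _ hi => ?_) hx0
    · rw [inner_smul_left, inner_smul_right, hux i j hij]; simp
    · simp [hAux i j hij]
    · have : c i • u i = cfc (tent i r) A (c i • y i) := by simp [hu]
      rw [this] at hi ⊢
      exact hlt i _ hi

lemma lt_norm_apply_of_mem_eigenspaceAbove {A : E →L[ℂ] E} (hA : IsSelfAdjoint A) {ε : ℝ}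
    (hε : 0 ≤ ε) {x : E} (hx : x ∈ eigenspaceAbove A ε) (hx0 : x ≠ 0) :
    ε ^ 2 * ‖x‖ ^ 2 < ‖A x‖ ^ 2 := by
  classical
  have hsymm := ContinuousLinearMap.isSelfAdjoint_iff_isSymmetric.1 hA
  rw [eigenspaceAbove, iSup_subtype', Submodule.mem_iSup_iff_exists_finsupp] at hx
  obtain ⟨f, hf, rfl⟩ := hx
  have horth : ∀ i j : Set.Ioi ε, i ≠ j → inner ℂ (f i) (f j) = 0 := fun i j hij => by
    have hij' : ((i : ℝ) : ℂ) ≠ ((j : ℝ) : ℂ) := by simpa [Subtype.ext_iff] using hij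
    exact hsymm.orthogonalFamily_eigenspaces hij' ⟨f i, hf i⟩ ⟨f j, hf j⟩
  have hAf : ∀ i : Set.Ioi ε, A (f i) = ((i : ℝ) : ℂ) • f i := fun i =>
    Module.End.mem_eigenspace_iff.1 (hf i)
  refine norm_sum_lt_of_orthogonal f.support (A : E →ₗ[ℂ] E) hε f
    (fun i _ j _ hij => horth i j hij) (fun i _ j _ hij => ?_) (fun i _ hi => ?_) hx0
  · simp [hAf, horth i j hij]
  · have hi' : ε < i := i.2
    simp only [ContinuousLinearMap.coe_coe, hAf, norm_smul, Complex.norm_real, Real.norm_eq_abs,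
      abs_of_pos (hε.trans_lt hi')]
    exact mul_lt_mul_of_pos_right hi' (norm_pos_iff.2 hi)

lemma formGT_of_le_rank {A : E →L[ℂ] E} (hA : IsSelfAdjoint A) {ε : ℝ} (hε : 0 ≤ ε) {n : ℕ}
    (hn : n ≤ Module.rank ℂ (eigenspaceAbove A ε)) :
    FormGT (fun x => ‖A x‖ ^ 2) (ε ^ 2) n := by
  obtain ⟨v, hv⟩ := Module.le_rank_iff.1 hn
  have hv' : LinearIndependent ℂ fun i => (v i : E) :=
    hv.map' (eigenspaceAbove A ε).subtype (Submodule.ker_subtype _)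
  refine ⟨Submodule.span ℂ (Set.range fun i => (v i : E)),
    FiniteDimensional.span_of_finite ℂ (Set.finite_range _), ?_, fun x hx hx0 => ?_⟩
  · simpa using finrank_span_eq_card hv'
  · refine lt_norm_apply_of_mem_eigenspaceAbove hA hε ?_ hx0
    exact Submodule.span_le.2 (by rintro _ ⟨i, rfl⟩; exact (v i).2) hx

/-- The admissible bounds in the definition of the `n`-th singular value. -/
def singularBounds (T : E →L[ℂ] E) (n : ℕ) : Set ℝ :=
  {ε : ℝ | 0 ≤ ε ∧ (spectrum ℝ (CFC.abs T) ∩ Set.Ioi ε).Finite ∧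
    Module.rank ℂ (eigenspaceAbove (CFC.abs T) ε) < n}

lemma formLE_of_mem_singularBounds {T : E →L[ℂ] E} {n : ℕ} {ε : ℝ}
    (h : ε ∈ singularBounds T (n + 1)) : FormLE (fun x => ‖T x‖ ^ 2) (ε ^ 2) n := by
  obtain ⟨hε, hfin, hrank⟩ := h
  have hlt : Module.rank ℂ (eigenspaceAbove (CFC.abs T) ε) < Cardinal.aleph0 :=
    hrank.trans (Cardinal.natCast_lt_aleph0)
  have hF : FiniteDimensional ℂ (eigenspaceAbove (CFC.abs T) ε) :=
    Module.rank_lt_aleph0_iff.1 hlt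
  refine ⟨_, hF, ?_, fun x hx => ?_⟩
  · rw [← Module.finrank_eq_rank] at hrank
    have : Module.finrank ℂ (eigenspaceAbove (CFC.abs T) ε) < n + 1 := by exact_mod_cast hrank
    omega
  · simp only [← norm_abs_apply T]
    rw [← mul_pow]
    gcongr
    exact norm_apply_le_of_mem_orthogonal (CFC.abs_nonneg T) hε hfin hx

/-- A bound fails to be admissible either because the eigenvectors above `ε` span too much or
because the spectrum above `ε` is infinite; each case supplies the required subspace. -/
lemma formGT_of_notMem_singularBounds {T : E →L[ℂ] E} {n : ℕ} {ε : ℝ} (hε : 0 ≤ ε)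
    (h : ε ∉ singularBounds T n) : FormGT (fun x => ‖T x‖ ^ 2) (ε ^ 2) n := by
  simp_rw [← norm_abs_apply T]
  by_cases hfin : (spectrum ℝ (CFC.abs T) ∩ Set.Ioi ε).Finite
  · refine formGT_of_le_rank (CFC.abs_nonneg T).isSelfAdjoint hε ?_
    by_contra! hlt
    exact h ⟨hε, hfin, hlt⟩
  · exact formGT_of_infinite_spectrum (CFC.abs_nonneg T) hε hfin n

lemma formLE_or_formGT (T : E →L[ℂ] E) {ε : ℝ} (hε : 0 ≤ ε) (n : ℕ) :
    FormLE (fun x => ‖T x‖ ^ 2) (ε ^ 2) n ∨ FormGT (fun x => ‖T x‖ ^ 2) (ε ^ 2) (n + 1) := by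
  by_cases h : ε ∈ singularBounds T (n + 1)
  · exact .inl (formLE_of_mem_singularBounds h)
  · exact .inr (formGT_of_notMem_singularBounds hε h)

end Spectral

/-! ### The counting function and its relation to `s_n` -/

section Counting

variable {E : Type*} [NormedAddCommGroup E] [InnerProductSpace ℂ E]

/-- The number of singular values of `T` exceeding `ε`. -/
def singCount (T : E →L[ℂ] E) (ε : ℝ) : ℕ∞ :=
  ⨅ (k : ℕ) (_ : FormLE (fun x => ‖T x‖ ^ 2) (ε ^ 2) k), (k : ℕ∞)

lemma singCount_le {T : E →L[ℂ] E} {ε : ℝ} {k : ℕ}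
    (h : FormLE (fun x => ‖T x‖ ^ 2) (ε ^ 2) k) : singCount T ε ≤ k :=
  iInf₂_le k h

lemma formLE_of_singCount_eq {T : E →L[ℂ] E} {ε : ℝ} {k : ℕ} (h : singCount T ε = k) :
    FormLE (fun x => ‖T x‖ ^ 2) (ε ^ 2) k := by
  by_contra hk
  have : ((k + 1 : ℕ) : ℕ∞) ≤ singCount T ε := le_iInf₂ fun j hj => by
    have : k < j := by
      by_contra! hjk
      exact hk (hj.mono le_rfl hjk)
    exact_mod_cast this
  rw [h] at this
  norm_cast at this
  omega

lemma le_singCount_of_formGT {T : E →L[ℂ] E} {ε : ℝ} {n : ℕ}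
    (h : FormGT (fun x => ‖T x‖ ^ 2) (ε ^ 2) n) : (n : ℕ∞) ≤ singCount T ε :=
  le_iInf₂ fun _ hk => by exact_mod_cast h.le hk

variable [CompleteSpace E]

lemma formGT_of_le_singCount {T : E →L[ℂ] E} {ε : ℝ} (hε : 0 ≤ ε) {n : ℕ}
    (h : (n : ℕ∞) ≤ singCount T ε) : FormGT (fun x => ‖T x‖ ^ 2) (ε ^ 2) n := by
  cases n with
  | zero =>
    exact ⟨⊥, inferInstance, by simp, fun x hx hx0 => absurd (by simpa using hx) hx0⟩
  | succ n =>
    refine (formLE_or_formGT T hε n).resolve_left fun hle => ?_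
    have := h.trans (singCount_le hle)
    norm_cast at this
    omega

lemma le_singCount_of_lt {T : E →L[ℂ] E} {ε : ℝ} (hε : 0 ≤ ε) {n : ℕ}
    (h : ε < singularValue T n) : (n : ℕ∞) ≤ singCount T ε := by
  refine le_singCount_of_formGT (formGT_of_notMem_singularBounds hε fun hmem => ?_)
  have hb : BddBelow (singularBounds T n) := ⟨0, fun _ h => h.1⟩
  exact absurd (csInf_le hb hmem) (not_le.2 h)

/-- Together with `le_singCount_of_lt` this makes `N` and `s` inverse to each other up to ties. The
case `n = 0` must be excluded: no bound is admissible there, so the infimum of the empty set gives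
`s_0 = 0`. -/
lemma le_singularValue_of_le {T : E →L[ℂ] E} {ε : ℝ} {n : ℕ} (hn : 1 ≤ n)
    (h : (n : ℕ∞) ≤ singCount T ε) : ε ≤ singularValue T n := by
  obtain ⟨n, rfl⟩ := Nat.exists_eq_add_of_le' hn
  refine le_csInf (s := singularBounds T (n + 1)) ⟨‖T‖, ?_⟩ fun ε' hε' => ?_
  · by_contra hmem
    have h0 : FormLE (fun x => ‖T x‖ ^ 2) (‖T‖ ^ 2) 0 :=
      ⟨⊥, inferInstance, by simp, fun x _ => by
        simp only [← mul_pow]; gcongr; exact T.le_opNorm x⟩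
    have := (formGT_of_notMem_singularBounds (norm_nonneg T) hmem).le h0
    omega
  · by_contra! hlt
    have h1 : FormLE (fun x => ‖T x‖ ^ 2) (ε ^ 2) n :=
      (formLE_of_mem_singularBounds hε').mono (by have := hε'.1; gcongr) le_rfl
    have := h.trans (singCount_le h1)
    norm_cast at this
    omega

lemma singularValue_nonneg (T : E →L[ℂ] E) (n : ℕ) : 0 ≤ singularValue T n :=
  Real.sInf_nonneg fun _ h => h.1

end Counting

/-! ### Exchanging `n s_n^p` for `ε^p N(ε)` -/

section Limits

variable {s : ℕ → ℝ} {N : ℝ → ℕ∞} {p : ℝ}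

lemma tendsto_rpow_nhdsGT_zero (hp : 0 < p) : Tendsto (fun ε : ℝ => ε ^ p) (𝓝[>] 0) (𝓝 0) := by
  have : Tendsto (fun ε : ℝ => ε ^ p) (𝓝 0) (𝓝 (0 ^ p)) :=
    (Real.continuousAt_rpow_const 0 p (.inr hp.le)).tendsto
  rw [Real.zero_rpow hp.ne'] at this
  exact this.mono_left nhdsWithin_le_nhds

lemma ofReal_mul_natCast {x : ℝ} (hx : 0 ≤ x) (n : ℕ) :
    ENNReal.ofReal x * ((n : ℕ∞) : ℝ≥0∞) = ENNReal.ofReal (n * x) := by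
  rw [mul_comm (n : ℝ), ENNReal.ofReal_mul hx]; simp

/-- Every `n ≤ N ε` satisfies `n ε^p ≤ c`: for large `n` because `ε ≤ s n`, for the finitely many
others because `ε` is small. This also forces `N ε` to be finite. -/
lemma eventually_count_le (hp : 0 < p)
    (h : ∀ ε > 0, ∀ n : ℕ, 1 ≤ n → (n : ℕ∞) ≤ N ε → ε ≤ s n) {c : ℝ} (hc : 0 < c)
    (hev : ∀ᶠ n : ℕ in atTop, n * s n ^ p < c) :
    ∀ᶠ ε in 𝓝[>] (0 : ℝ), ENNReal.ofReal (ε ^ p) * (N ε : ℝ≥0∞) ≤ ENNReal.ofReal c := by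
  obtain ⟨n₀, hn₀⟩ := eventually_atTop.1 hev
  have hsmall : ∀ᶠ ε in 𝓝[>] (0 : ℝ), n₀ * ε ^ p < c := by
    have := (tendsto_rpow_nhdsGT_zero hp).const_mul (n₀ : ℝ)
    rw [mul_zero] at this
    exact this.eventually_lt_const hc
  filter_upwards [hsmall, self_mem_nhdsWithin] with ε hεs hε
  replace hε : 0 < ε := hε
  have hεp : 0 < ε ^ p := Real.rpow_pos_of_pos hε p
  have key : ∀ n : ℕ, (n : ℕ∞) ≤ N ε → n * ε ^ p ≤ c := fun n hn => by
    by_cases hnn : n₀ ≤ n ∧ 1 ≤ n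
    · have h1 := h ε hε n hnn.2 hn
      calc n * ε ^ p ≤ n * s n ^ p := by gcongr
        _ ≤ c := (hn₀ n hnn.1).le
    · have : n ≤ n₀ := by omega
      calc n * ε ^ p ≤ n₀ * ε ^ p := by gcongr
        _ ≤ c := hεs.le
  cases hN : N ε with
  | top =>
    exfalso
    obtain ⟨n, hn⟩ := exists_nat_gt (c / ε ^ p)
    have := key n (by simp [hN])
    rw [div_lt_iff₀ hεp] at hn
    linarith
  | coe n =>
    rw [ofReal_mul_natCast hεp.le]
    exact ENNReal.ofReal_le_ofReal (key n hN.ge)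

lemma eventually_le_of_count_le (hp : 0 < p) (hs : ∀ n, 0 ≤ s n)
    (h : ∀ ε > 0, ∀ n : ℕ, ε < s n → (n : ℕ∞) ≤ N ε) {c : ℝ} (hc : 0 ≤ c)
    (hev : ∀ᶠ ε in 𝓝[>] (0 : ℝ), ENNReal.ofReal (ε ^ p) * (N ε : ℝ≥0∞) ≤ ENNReal.ofReal c) :
    ∀ᶠ n : ℕ in atTop, n * s n ^ p ≤ c := by
  obtain ⟨δ, hδ, hδ'⟩ := mem_nhdsGT_iff_exists_Ioc_subset.1 hev
  replace hδ : 0 < δ := hδ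
  have key : ∀ ε, 0 < ε → ε ≤ δ → ∀ n, ε < s n → n * ε ^ p ≤ c := fun ε hε hεδ n hn => by
    have h1 : ENNReal.ofReal (ε ^ p) * (N ε : ℝ≥0∞) ≤ ENNReal.ofReal c := hδ' ⟨hε, hεδ⟩
    have h2 : ((n : ℕ∞) : ℝ≥0∞) ≤ N ε := by exact_mod_cast h ε hε n hn
    have h3 := (mul_le_mul_right h2 (ENNReal.ofReal (ε ^ p))).trans h1
    rw [ofReal_mul_natCast (by positivity)] at h3
    exact (ENNReal.ofReal_le_ofReal_iff hc).1 h3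
  obtain ⟨n₀, hn₀⟩ := exists_nat_gt (c / δ ^ p)
  have hδp : 0 < δ ^ p := Real.rpow_pos_of_pos hδ p
  filter_upwards [eventually_ge_atTop n₀] with n hn
  have hsn : s n ≤ δ := by
    by_contra! hlt
    have := key δ hδ le_rfl n hlt
    rw [div_lt_iff₀ hδp] at hn₀
    have : (n₀ : ℝ) * δ ^ p ≤ n * δ ^ p := by gcongr
    linarith
  rcases (hs n).eq_or_lt with h0 | h0
  · rw [← h0, Real.zero_rpow hp.ne']; simpa using hc
  -- The count controls only `ε < s n`, so the bound at `s n` is reached by letting `ε` increase to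
  -- it.
  · have hcont : Tendsto (fun ε : ℝ => n * ε ^ p) (𝓝[<] s n) (𝓝 (n * s n ^ p)) :=
      (((Real.continuousAt_rpow_const (s n) p (.inr hp.le)).tendsto).const_mul _).mono_left
        nhdsWithin_le_nhds
    refine le_of_tendsto hcont ?_
    filter_upwards [Ioo_mem_nhdsLT h0] with ε hε
    exact key ε hε.1 (hε.2.le.trans hsn) n hε.2

lemma eventually_le_count (hp : 0 < p) (hs : ∀ n, 0 ≤ s n)
    (h : ∀ ε > 0, ∀ n : ℕ, ε < s n → (n : ℕ∞) ≤ N ε) {c c' : ℝ} (hc : 0 < c) (hc' : c' < c)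
    (hev : ∀ᶠ n : ℕ in atTop, c < n * s n ^ p) :
    ∀ᶠ ε in 𝓝[>] (0 : ℝ), ENNReal.ofReal c' ≤ ENNReal.ofReal (ε ^ p) * (N ε : ℝ≥0∞) := by
  -- The index tested at level `ε` is `⌊c / ε^p⌋`; rounding loses at most `ε^p`, which the gap `c -
  -- c'` absorbs.
  have hfloor : Tendsto (fun ε : ℝ => ⌊c / ε ^ p⌋₊) (𝓝[>] 0) atTop := by
    refine tendsto_nat_floor_atTop.comp ?_
    have h0 : Tendsto (fun ε : ℝ => ε ^ p) (𝓝[>] 0) (𝓝[>] 0) :=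
      tendsto_nhdsWithin_iff.2 ⟨tendsto_rpow_nhdsGT_zero hp, by
        filter_upwards [self_mem_nhdsWithin] with ε hε using Real.rpow_pos_of_pos hε p⟩
    simpa [div_eq_mul_inv] using (tendsto_inv_nhdsGT_zero.comp h0).const_mul_atTop hc
  filter_upwards [hfloor.eventually hev, self_mem_nhdsWithin,
    (tendsto_rpow_nhdsGT_zero hp).eventually_lt_const (sub_pos.2 hc')] with ε hn hε hεc
  replace hε : 0 < ε := hε
  have hεp : 0 < ε ^ p := Real.rpow_pos_of_pos hε p
  set n := ⌊c / ε ^ p⌋₊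
  have hnle : n * ε ^ p ≤ c := by
    rw [← le_div_iff₀ hεp]; exact Nat.floor_le (by positivity)
  have hnge : c < (n + 1) * ε ^ p := by
    rw [← div_lt_iff₀ hεp]; exact Nat.lt_floor_add_one _
  have hεs : ε < s n := by
    by_contra! hle
    have : (n : ℝ) * s n ^ p ≤ n * ε ^ p := by
      have := hs n
      gcongr
    linarith
  have h2 : ((n : ℕ∞) : ℝ≥0∞) ≤ N ε := by exact_mod_cast h ε hε n hεs
  refine le_trans ?_ (mul_le_mul_right h2 (ENNReal.ofReal (ε ^ p)))
  rw [ofReal_mul_natCast hεp.le]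
  exact ENNReal.ofReal_le_ofReal (by linarith)

lemma eventually_le_of_le_count (hp : 0 < p)
    (h : ∀ ε > 0, ∀ n : ℕ, 1 ≤ n → (n : ℕ∞) ≤ N ε → ε ≤ s n) {c : ℝ} (hc : 0 < c)
    (hev : ∀ᶠ ε in 𝓝[>] (0 : ℝ), ENNReal.ofReal c ≤ ENNReal.ofReal (ε ^ p) * (N ε : ℝ≥0∞)) :
    ∀ᶠ n : ℕ in atTop, c ≤ n * s n ^ p := by
  -- The level tested at index `n` is the solution of `n ε^p = c`.
  have ht : Tendsto (fun n : ℕ => (c / n) ^ p⁻¹) atTop (𝓝[>] 0) := by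
    refine tendsto_nhdsWithin_iff.2 ⟨?_, ?_⟩
    · have h1 : Tendsto (fun n : ℕ => c / n) atTop (𝓝 0) := tendsto_const_div_atTop_nhds_zero_nat c
      have := (Real.continuousAt_rpow_const 0 p⁻¹ (.inr (inv_nonneg.2 hp.le))).tendsto.comp h1
      rwa [Real.zero_rpow (inv_ne_zero hp.ne')] at this
    · filter_upwards [eventually_ge_atTop 1] with n hn
      have : (0 : ℝ) < n := by exact_mod_cast hn
      exact Real.rpow_pos_of_pos (by positivity) _
  filter_upwards [ht.eventually hev, eventually_ge_atTop 1] with n hn hn1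
  have hn0 : (0 : ℝ) < n := by exact_mod_cast hn1
  set ε := (c / n : ℝ) ^ p⁻¹ with hε
  have hε0 : 0 < ε := Real.rpow_pos_of_pos (by positivity) _
  have hεp : ε ^ p = c / n := Real.rpow_inv_rpow (by positivity) hp.ne'
  have hle : (n : ℕ∞) ≤ N ε := by
    cases hN : N ε with
    | top => simp
    | coe k =>
      rw [hN, ofReal_mul_natCast (by positivity), ENNReal.ofReal_le_ofReal_iff (by positivity),
        hεp] at hn
      have : (n : ℝ) ≤ k := by
        rw [mul_div_assoc', le_div_iff₀ hn0, mul_comm] at hn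
        exact le_of_mul_le_mul_right hn hc
      exact_mod_cast this
  have := h ε hε0 n hn1 hle
  calc c = n * ε ^ p := by rw [hεp]; field_simp
    _ ≤ n * s n ^ p := by gcongr

lemma limsup_eq_limsup_count (hp : 0 < p) (hs : ∀ n, 0 ≤ s n)
    (h₁ : ∀ ε > 0, ∀ n : ℕ, ε < s n → (n : ℕ∞) ≤ N ε)
    (h₂ : ∀ ε > 0, ∀ n : ℕ, 1 ≤ n → (n : ℕ∞) ≤ N ε → ε ≤ s n) :
    limsup (fun n : ℕ => ENNReal.ofReal (n * s n ^ p)) atTop =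
      limsup (fun ε : ℝ => ENNReal.ofReal (ε ^ p) * (N ε : ℝ≥0∞)) (𝓝[>] 0) := by
  have hpos : ∀ n : ℕ, 0 ≤ n * s n ^ p := fun n =>
    mul_nonneg n.cast_nonneg (Real.rpow_nonneg (hs n) p)
  apply le_antisymm
  · refine le_of_forall_gt_imp_ge_of_dense fun C hC => ?_
    rcases eq_or_ne C ⊤ with rfl | hC'
    · exact le_top
    refine limsup_le_of_le (h := ?_)
    have hev := eventually_lt_of_limsup_lt hC
    rw [← ENNReal.ofReal_toReal hC'] at hev ⊢
    filter_upwards [eventually_le_of_count_le hp hs h₁ ENNReal.toReal_nonneg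
      (hev.mono fun _ h => h.le)] with n hn
    exact ENNReal.ofReal_le_ofReal hn
  · refine le_of_forall_gt_imp_ge_of_dense fun C hC => ?_
    rcases eq_or_ne C ⊤ with rfl | hC'
    · exact le_top
    refine limsup_le_of_le (h := ?_)
    have hev := eventually_lt_of_limsup_lt hC
    have hC0 : 0 < C.toReal := ENNReal.toReal_pos (pos_of_gt hC).ne' hC'
    rw [← ENNReal.ofReal_toReal hC'] at hev ⊢
    exact eventually_count_le hp h₂ hC0
      (hev.mono fun n hn => (ENNReal.ofReal_lt_ofReal_iff hC0).1 hn)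

lemma liminf_eq_liminf_count (hp : 0 < p) (hs : ∀ n, 0 ≤ s n)
    (h₁ : ∀ ε > 0, ∀ n : ℕ, ε < s n → (n : ℕ∞) ≤ N ε)
    (h₂ : ∀ ε > 0, ∀ n : ℕ, 1 ≤ n → (n : ℕ∞) ≤ N ε → ε ≤ s n) :
    liminf (fun n : ℕ => ENNReal.ofReal (n * s n ^ p)) atTop =
      liminf (fun ε : ℝ => ENNReal.ofReal (ε ^ p) * (N ε : ℝ≥0∞)) (𝓝[>] 0) := by
  apply le_antisymm
  · refine le_of_forall_lt_imp_le_of_dense fun C hC => ?_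
    obtain ⟨D, hCD, hD⟩ := exists_between hC
    have hD' : D ≠ ⊤ := hD.ne_top
    have hC' : C ≠ ⊤ := hC.ne_top
    have hD0 : 0 < D.toReal := ENNReal.toReal_pos (pos_of_gt hCD).ne' hD'
    refine le_liminf_of_le (h := ?_)
    have hev := eventually_lt_of_lt_liminf hD
    rw [← ENNReal.ofReal_toReal hD'] at hev
    rw [← ENNReal.ofReal_toReal hC']
    refine eventually_le_count hp hs h₁ hD0 ((ENNReal.toReal_lt_toReal hC' hD').2 hCD)
      (hev.mono fun n hn => ?_)
    exact (ENNReal.ofReal_lt_ofReal_iff_of_nonneg hD0.le).1 hn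
  · refine le_of_forall_lt_imp_le_of_dense fun C hC => ?_
    have hC' : C ≠ ⊤ := hC.ne_top
    rcases eq_or_ne C 0 with rfl | hC0
    · exact bot_le
    have hC0' : 0 < C.toReal := ENNReal.toReal_pos hC0 hC'
    refine le_liminf_of_le (h := ?_)
    have hev := eventually_lt_of_lt_liminf hC
    rw [← ENNReal.ofReal_toReal hC'] at hev ⊢
    filter_upwards [eventually_le_of_le_count hp h₂ hC0' (hev.mono fun _ h => h.le)] with n hn
    exact ENNReal.ofReal_le_ofReal hn

variable {E : Type*} [NormedAddCommGroup E] [InnerProductSpace ℂ E] [CompleteSpace E]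

lemma limsup_scaledSingularValue (hp : 0 < p) (T : E →L[ℂ] E) :
    limsup (scaledSingularValue p T) atTop =
      limsup (fun ε : ℝ => ENNReal.ofReal (ε ^ p) * (singCount T ε : ℝ≥0∞)) (𝓝[>] 0) :=
  limsup_eq_limsup_count hp (singularValue_nonneg T) (fun _ hε _ h => le_singCount_of_lt hε.le h)
    (fun _ _ _ hn h => le_singularValue_of_le hn h)

lemma liminf_scaledSingularValue (hp : 0 < p) (T : E →L[ℂ] E) :
    liminf (scaledSingularValue p T) atTop =
      liminf (fun ε : ℝ => ENNReal.ofReal (ε ^ p) * (singCount T ε : ℝ≥0∞)) (𝓝[>] 0) :=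
  liminf_eq_liminf_count hp (singularValue_nonneg T) (fun _ hε _ h => le_singCount_of_lt hε.le h)
    (fun _ _ _ hn h => le_singularValue_of_le hn h)

end Limits

/-! ### Operators with rapidly decaying singular values -/

section Subspaces

variable {E G K : Type*} [NormedAddCommGroup E] [InnerProductSpace ℂ E]
  [NormedAddCommGroup G] [InnerProductSpace ℂ G] [NormedAddCommGroup K] [InnerProductSpace ℂ K]

lemma exists_submodule_ge {ι : Type*} (s : Finset ι) (F : ι → Submodule ℂ E)
    (hF : ∀ i ∈ s, FiniteDimensional ℂ (F i)) :
    ∃ F' : Submodule ℂ E, FiniteDimensional ℂ F' ∧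
      Module.finrank ℂ F' ≤ ∑ i ∈ s, Module.finrank ℂ (F i) ∧ ∀ i ∈ s, F i ≤ F' := by
  classical
  induction s using Finset.induction_on with
  | empty => exact ⟨⊥, inferInstance, by simp, by simp⟩
  | insert a s ha ih =>
    obtain ⟨F', hF', hle, hsub⟩ := ih fun i hi => hF i (Finset.mem_insert_of_mem hi)
    have := hF a (Finset.mem_insert_self _ _)
    refine ⟨F a ⊔ F', inferInstance, ?_, fun i hi => ?_⟩
    · rw [Finset.sum_insert ha]
      exact (Submodule.finrank_add_le_finrank_add_finrank _ _).trans (by gcongr)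
    · rcases Finset.mem_insert.1 hi with rfl | hi
      · exact le_sup_left
      · exact (hsub i hi).trans le_sup_right

/-- The subspace is the image of `F` under the adjoint of `B`. -/
lemma exists_submodule_comap [CompleteSpace E] [CompleteSpace G] (B : E →L[ℂ] G)
    (F : Submodule ℂ G) [FiniteDimensional ℂ F] :
    ∃ F' : Submodule ℂ E, FiniteDimensional ℂ F' ∧ Module.finrank ℂ F' ≤ Module.finrank ℂ F ∧
      ∀ x ∈ F'ᗮ, B x ∈ Fᗮ := by
  refine ⟨F.map (B.adjoint : G →ₗ[ℂ] E), inferInstance, Submodule.finrank_map_le _ F,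
    fun x hx => ?_⟩
  rw [Submodule.mem_orthogonal] at hx ⊢
  intro u hu
  rw [← B.adjoint_inner_left]
  exact hx _ (Submodule.mem_map_of_mem hu)

/-- The singular values of `T` decay faster than any power. -/
def Rapid (T : E →L[ℂ] G) : Prop :=
  ∀ q : ℝ, 0 < q → ∃ C : ℝ, ∀ ε : ℝ, 0 < ε → ε ≤ 1 → ∃ F : Submodule ℂ E,
    FiniteDimensional ℂ F ∧ (Module.finrank ℂ F : ℝ) ≤ C * ε ^ (-q) ∧ ∀ x ∈ Fᗮ, ‖T x‖ ≤ ε * ‖x‖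

lemma Rapid.of_le {T : E →L[ℂ] G} (M : ℝ)
    (h : ∀ q : ℝ, 0 < q → ∃ C : ℝ, ∀ ε : ℝ, 0 < ε → ε ≤ 1 → ∃ F : Submodule ℂ E,
      FiniteDimensional ℂ F ∧ (Module.finrank ℂ F : ℝ) ≤ C * ε ^ (-q) ∧
        ∀ x ∈ Fᗮ, ‖T x‖ ≤ M * ε * ‖x‖) : Rapid T := by
  intro q hq
  obtain ⟨C, hC⟩ := h q hq
  -- Taking `M' ≥ 1` keeps `ε / M'` in the admissible range `(0, 1]`.
  set M' : ℝ := max M 1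
  have hM' : 1 ≤ M' := le_max_right _ _
  have hM0 : 0 < M' := one_pos.trans_le hM'
  refine ⟨C * M' ^ q, fun ε hε hε1 => ?_⟩
  obtain ⟨F, hF, hFk, hFx⟩ := hC (ε / M') (by positivity)
    ((div_le_one hM0).2 (hε1.trans hM'))
  refine ⟨F, hF, hFk.trans_eq ?_, fun x hx => (hFx x hx).trans ?_⟩
  · rw [Real.div_rpow hε.le hM0.le, Real.rpow_neg hM0.le, div_inv_eq_mul]; ring
  · calc M * (ε / M') * ‖x‖ ≤ M' * (ε / M') * ‖x‖ := by gcongr; exact le_max_left _ _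
      _ = ε * ‖x‖ := by field_simp

lemma Rapid.add {T₁ T₂ : E →L[ℂ] G} (h₁ : Rapid T₁) (h₂ : Rapid T₂) : Rapid (T₁ + T₂) := by
  refine Rapid.of_le 2 fun q hq => ?_
  obtain ⟨C₁, hC₁⟩ := h₁ q hq
  obtain ⟨C₂, hC₂⟩ := h₂ q hq
  refine ⟨C₁ + C₂, fun ε hε hε1 => ?_⟩
  obtain ⟨F₁, hF₁, hk₁, hx₁⟩ := hC₁ ε hε hε1
  obtain ⟨F₂, hF₂, hk₂, hx₂⟩ := hC₂ ε hε hε1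
  refine ⟨F₁ ⊔ F₂, inferInstance, ?_, fun x hx => ?_⟩
  · have : (Module.finrank ℂ ↥(F₁ ⊔ F₂) : ℝ) ≤ Module.finrank ℂ F₁ + Module.finrank ℂ F₂ := by
      exact_mod_cast Submodule.finrank_add_le_finrank_add_finrank F₁ F₂
    linarith
  · rw [← Submodule.inf_orthogonal] at hx
    have := norm_add_le (T₁ x) (T₂ x)
    simp only [add_apply]
    linarith [hx₁ x hx.1, hx₂ x hx.2]

lemma Rapid.comp_left {T : E →L[ℂ] G} (h : Rapid T) (B : G →L[ℂ] K) : Rapid (B ∘L T) := by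
  refine Rapid.of_le ‖B‖ fun q hq => ?_
  obtain ⟨C, hC⟩ := h q hq
  refine ⟨C, fun ε hε hε1 => ?_⟩
  obtain ⟨F, hF, hk, hx⟩ := hC ε hε hε1
  refine ⟨F, hF, hk, fun x hxF => ?_⟩
  calc ‖B (T x)‖ ≤ ‖B‖ * ‖T x‖ := B.le_opNorm _
    _ ≤ ‖B‖ * (ε * ‖x‖) := by gcongr; exact hx x hxF
    _ = _ := by ring

lemma Rapid.comp_right [CompleteSpace E] [CompleteSpace G] {T : G →L[ℂ] K} (h : Rapid T)
    (B : E →L[ℂ] G) : Rapid (T ∘L B) := by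
  refine Rapid.of_le ‖B‖ fun q hq => ?_
  obtain ⟨C, hC⟩ := h q hq
  refine ⟨C, fun ε hε hε1 => ?_⟩
  obtain ⟨F, hF, hk, hx⟩ := hC ε hε hε1
  obtain ⟨F', hF', hk', hx'⟩ := exists_submodule_comap B F
  refine ⟨F', hF', le_trans (by exact_mod_cast hk') hk, fun x hxF => ?_⟩
  calc ‖T (B x)‖ ≤ ε * ‖B x‖ := hx _ (hx' x hxF)
    _ ≤ ε * (‖B‖ * ‖x‖) := by gcongr; exact B.le_opNorm _
    _ = _ := by ring

lemma Rapid.adjoint [CompleteSpace E] [CompleteSpace G] {T : E →L[ℂ] G} (h : Rapid T) :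
    Rapid T.adjoint := by
  intro q hq
  obtain ⟨C, hC⟩ := h q hq
  refine ⟨C, fun ε hε hε1 => ?_⟩
  obtain ⟨F, hF, hk, hx⟩ := hC ε hε hε1
  have h1 : FormLE (fun x => ‖T x‖ ^ 2) (ε ^ 2) (Module.finrank ℂ F) :=
    ⟨F, hF, le_rfl, fun x hxF => by
      simp only [← mul_pow]; gcongr; exact hx x hxF⟩
  obtain ⟨F', hF', hk', hx'⟩ := FormLE.adjoint (S := (T : E →ₗ[ℂ] G)) (R := T.adjoint)
    (fun x y => (T.adjoint_inner_right x y).symm) (sq_nonneg ε) h1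
  refine ⟨F', hF', le_trans (by exact_mod_cast hk') hk, fun x hxF => ?_⟩
  have := hx' x hxF
  rw [← mul_pow] at this
  exact (pow_le_pow_iff_left₀ (norm_nonneg _) (by positivity) two_ne_zero).1 this

lemma exists_common_rapid {ι : Type*} [Fintype ι] {T : ι → E →L[ℂ] G} (h : ∀ i, Rapid (T i))
    {q : ℝ} (hq : 0 < q) : ∃ C : ℝ, 0 ≤ C ∧ ∀ ε : ℝ, 0 < ε → ε ≤ 1 → ∃ k : ℕ,
      (k : ℝ) ≤ C * ε ^ (-q) ∧ ∀ i, ∃ F : Submodule ℂ E, FiniteDimensional ℂ F ∧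
        Module.finrank ℂ F ≤ k ∧ ∀ x ∈ Fᗮ, ‖T i x‖ ≤ ε * ‖x‖ := by
  choose C hC using fun i => h i q hq
  refine ⟨∑ i, |C i|, by positivity, fun ε hε hε1 => ⟨⌊(∑ i, |C i|) * ε ^ (-q)⌋₊,
    Nat.floor_le (by positivity), fun i => ?_⟩⟩
  obtain ⟨F, hF, hk, hx⟩ := hC i ε hε hε1
  refine ⟨F, hF, Nat.le_floor (hk.trans ?_), hx⟩
  gcongr
  exact (le_abs_self _).trans
    (Finset.single_le_sum (f := fun i => |C i|) (fun _ _ => abs_nonneg _) (Finset.mem_univ i))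

end Subspaces

/-! ### Almost orthogonal sums versus direct sums -/

section AlmostOrthogonal

variable {ι : Type*} [Fintype ι] {H : Type*} [NormedAddCommGroup H] [InnerProductSpace ℂ H]

/-- The row operator `(f_l) ↦ ∑ A_l f_l` on the direct sum of copies of `H`. -/
def rowOp (A : ι → H →L[ℂ] H) : PiLp 2 (fun _ : ι => H) →L[ℂ] H :=
  ∑ l, A l ∘L PiLp.proj 2 (fun _ : ι => H) l

lemma rowOp_apply (A : ι → H →L[ℂ] H) (f : PiLp 2 (fun _ : ι => H)) :
    rowOp A f = ∑ l, A l (f l) := by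
  simp [rowOp]

lemma abs_norm_sum_sq_sub_le (u : ι → H) {η r : ℝ}
    (h : ∀ j l, j ≠ l → ‖(inner ℂ (u j) (u l) : ℂ)‖ ≤ η * r) (hr : 0 ≤ η * r) :
    |‖∑ l, u l‖ ^ 2 - ∑ l, ‖u l‖ ^ 2| ≤ (Fintype.card ι ^ 2 * η) * r := by
  classical
  have h1 : ((‖∑ l, u l‖ ^ 2 - ∑ l, ‖u l‖ ^ 2 : ℝ) : ℂ) =
      ∑ j, ∑ l, if j = l then 0 else inner ℂ (u j) (u l) := by
    have h2 : ((‖∑ l, u l‖ ^ 2 : ℝ) : ℂ) = ∑ j, ∑ l, inner ℂ (u j) (u l) := by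
      have := inner_self_eq_norm_sq_to_K (𝕜 := ℂ) (∑ l, u l)
      rw [sum_inner] at this
      simp_rw [inner_sum] at this
      rw [this]; simp
    have h3 : ((∑ l, ‖u l‖ ^ 2 : ℝ) : ℂ) =
        ∑ j, ∑ l, if j = l then inner ℂ (u j) (u l) else 0 := by
      simp only [Finset.sum_ite_eq, Finset.mem_univ, if_true, inner_self_eq_norm_sq_to_K]
      simp
    rw [Complex.ofReal_sub, h2, h3, ← Finset.sum_sub_distrib]
    refine Finset.sum_congr rfl fun j _ => ?_
    rw [← Finset.sum_sub_distrib]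
    exact Finset.sum_congr rfl fun l _ => by split_ifs <;> simp
  rw [← Real.norm_eq_abs, ← Complex.norm_real, h1]
  calc ‖∑ j, ∑ l, if j = l then (0 : ℂ) else inner ℂ (u j) (u l)‖
      ≤ ∑ _j : ι, ∑ _l : ι, η * r := by
        refine (norm_sum_le _ _).trans (Finset.sum_le_sum fun j _ => (norm_sum_le _ _).trans
          (Finset.sum_le_sum fun l _ => ?_))
        split_ifs with hjl
        · simpa using hr
        · exact h j l hjl
    _ = _ := by simp; ring

lemma formGT_diagonal {A : ι → H →L[ℂ] H} {c : ℝ} {n : ι → ℕ}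
    (h : ∀ l, FormGT (fun x => ‖A l x‖ ^ 2) c (n l)) :
    FormGT (fun f : PiLp 2 (fun _ : ι => H) => ∑ l, ‖A l (f l)‖ ^ 2) c (∑ l, n l) := by
  choose V hV hn hx using h
  let Φ : (∀ l, V l) →ₗ[ℂ] PiLp 2 (fun _ : ι => H) :=
    (WithLp.linearEquiv 2 ℂ (ι → H)).symm.toLinearMap ∘ₗ
      LinearMap.pi fun l => (V l).subtype ∘ₗ LinearMap.proj l
  have hΦ : ∀ v l, Φ v l = v l := fun v l => rfl
  have hinj : Function.Injective Φ := fun v w hvw => by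
    ext l
    rw [← hΦ v l, hvw, hΦ]
  refine ⟨LinearMap.range Φ, inferInstance, ?_, ?_⟩
  · rw [LinearMap.finrank_range_of_inj hinj, Module.finrank_pi_fintype]
    exact Finset.sum_congr rfl fun l _ => hn l
  · rintro _ ⟨v, rfl⟩ hv0
    rw [PiLp.norm_sq_eq_of_L2, Finset.mul_sum]
    have key : ∀ l, (v l : H) ≠ 0 → c * ‖Φ v l‖ ^ 2 < ‖A l (Φ v l)‖ ^ 2 := fun l hl =>
      hx l _ (v l).2 hl
    refine Finset.sum_lt_sum (fun l _ => ?_) ?_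
    · by_cases hl : (v l : H) = 0
      · simp [hΦ, hl]
      · exact (key l hl).le
    · by_contra! hcon
      refine hv0 ?_
      ext l
      by_contra hl
      exact absurd (hcon l (Finset.mem_univ l)) (not_le.2 (key l hl))

/-- Each `T j l` with `j ≠ l` is at most `η` off a subspace of dimension at most `k`. -/
def OffDiagonalLE (T : ι → ι → H →L[ℂ] H) (η : ℝ) (k : ℕ) : Prop :=
  ∀ j l, j ≠ l → ∃ F : Submodule ℂ H, FiniteDimensional ℂ F ∧ Module.finrank ℂ F ≤ k ∧
    ∀ x ∈ Fᗮ, ‖T j l x‖ ≤ η * ‖x‖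

variable [CompleteSpace H]

/-- The cross terms are `⟪f j, (A j)* A l (f l)⟫`, at most `η ‖f‖²` once each `f l` avoids the
exceptional subspaces. -/
lemma formLE_cross_row {A : ι → H →L[ℂ] H} {η : ℝ} (hη : 0 ≤ η) {k : ℕ}
    (h : OffDiagonalLE (fun j l => (A j).adjoint ∘L A l) η k) :
    FormLE (fun f : PiLp 2 (fun _ : ι => H) => |‖rowOp A f‖ ^ 2 - ∑ l, ‖A l (f l)‖ ^ 2|)
      (Fintype.card ι ^ 2 * η) (Fintype.card ι ^ 2 * k) := by
  have h' : ∀ i : ι × ι, ∃ F : Submodule ℂ (PiLp 2 (fun _ : ι => H)), FiniteDimensional ℂ F ∧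
      Module.finrank ℂ F ≤ k ∧
      (i.1 ≠ i.2 → ∀ f ∈ Fᗮ, ‖(A i.1).adjoint (A i.2 (f i.2))‖ ≤ η * ‖f i.2‖) := fun i => by
    by_cases hi : i.1 = i.2
    · exact ⟨⊥, inferInstance, by simp, fun h => absurd hi h⟩
    · obtain ⟨F, hF, hk, hx⟩ := h i.1 i.2 hi
      obtain ⟨F', hF', hk', hx'⟩ := exists_submodule_comap (PiLp.proj 2 (fun _ : ι => H) i.2) F
      exact ⟨F', hF', hk'.trans hk, fun _ f hf => hx _ (hx' f hf)⟩
  choose F hF hk hx using h'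
  obtain ⟨F', hF', hk', hle⟩ := exists_submodule_ge Finset.univ F fun i _ => hF i
  refine ⟨F', hF', hk'.trans ((Finset.sum_le_sum fun i _ => hk i).trans_eq ?_), fun f hf => ?_⟩
  · simp [sq]
  · simp only [rowOp_apply]
    refine abs_norm_sum_sq_sub_le (fun l => A l (f l)) (fun j l hjl => ?_) (by positivity)
    rw [← ContinuousLinearMap.adjoint_inner_right]
    have h1 := hx (j, l) hjl f (Submodule.orthogonal_le (hle _ (Finset.mem_univ _)) hf)
    calc ‖(inner ℂ (f j) ((A j).adjoint (A l (f l))) : ℂ)‖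
        ≤ ‖f j‖ * ‖(A j).adjoint (A l (f l))‖ := norm_inner_le_norm _ _
      _ ≤ ‖f‖ * (η * ‖f‖) := by
        refine mul_le_mul (PiLp.norm_apply_le f j) (h1.trans ?_) (norm_nonneg _) (norm_nonneg _)
        gcongr
        exact PiLp.norm_apply_le f l
      _ = η * ‖f‖ ^ 2 := by ring

/-- Here the cross terms are `⟪g, A j (A l)* g⟫`. -/
lemma formLE_cross_adjoint {A : ι → H →L[ℂ] H} {η : ℝ} (hη : 0 ≤ η) {k : ℕ}
    (h : OffDiagonalLE (fun j l => A j ∘L (A l).adjoint) η k) :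
    FormLE (fun g : H => |‖(∑ l, A l).adjoint g‖ ^ 2 - ∑ l, ‖(A l).adjoint g‖ ^ 2|)
      (Fintype.card ι ^ 2 * η) (Fintype.card ι ^ 2 * k) := by
  have h' : ∀ i : ι × ι, ∃ F : Submodule ℂ H, FiniteDimensional ℂ F ∧
      Module.finrank ℂ F ≤ k ∧
      (i.1 ≠ i.2 → ∀ g ∈ Fᗮ, ‖A i.1 ((A i.2).adjoint g)‖ ≤ η * ‖g‖) := fun i => by
    by_cases hi : i.1 = i.2
    · exact ⟨⊥, inferInstance, by simp, fun h => absurd hi h⟩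
    · obtain ⟨F, hF, hk, hx⟩ := h i.1 i.2 hi
      exact ⟨F, hF, hk, fun _ => hx⟩
  choose F hF hk hx using h'
  obtain ⟨F', hF', hk', hle⟩ := exists_submodule_ge Finset.univ F fun i _ => hF i
  refine ⟨F', hF', hk'.trans ((Finset.sum_le_sum fun i _ => hk i).trans_eq ?_), fun g hg => ?_⟩
  · simp [sq]
  · simp only [map_sum, sum_apply]
    refine abs_norm_sum_sq_sub_le (fun l => (A l).adjoint g) (fun j l hjl => ?_) (by positivity)
    rw [ContinuousLinearMap.adjoint_inner_left]
    have h1 := hx (j, l) hjl g (Submodule.orthogonal_le (hle _ (Finset.mem_univ _)) hg)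
    calc ‖(inner ℂ g (A j ((A l).adjoint g)) : ℂ)‖
        ≤ ‖g‖ * ‖A j ((A l).adjoint g)‖ := norm_inner_le_norm _ _
      _ ≤ ‖g‖ * (η * ‖g‖) := by gcongr
      _ = η * ‖g‖ ^ 2 := by ring

lemma formLE_diagonal {A : ι → H →L[ℂ] H} {c : ℝ} {k : ι → ℕ}
    (h : ∀ l, FormLE (fun x => ‖A l x‖ ^ 2) c (k l)) :
    FormLE (fun f : PiLp 2 (fun _ : ι => H) => ∑ l, ‖A l (f l)‖ ^ 2) c (∑ l, k l) := by
  have h' : ∀ l, ∃ F : Submodule ℂ (PiLp 2 (fun _ : ι => H)), FiniteDimensional ℂ F ∧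
      Module.finrank ℂ F ≤ k l ∧ ∀ f ∈ Fᗮ, ‖A l (f l)‖ ^ 2 ≤ c * ‖f l‖ ^ 2 := fun l => by
    obtain ⟨F, hF, hk, hx⟩ := h l
    obtain ⟨F', hF', hk', hx'⟩ := exists_submodule_comap (PiLp.proj 2 (fun _ : ι => H) l) F
    exact ⟨F', hF', hk'.trans hk, fun f hf => hx _ (hx' f hf)⟩
  choose F hF hk hx using h'
  obtain ⟨F', hF', hk', hle⟩ := exists_submodule_ge Finset.univ F fun i _ => hF i
  refine ⟨F', hF', hk'.trans (Finset.sum_le_sum fun i _ => hk i), fun f hf => ?_⟩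
  rw [PiLp.norm_sq_eq_of_L2, Finset.mul_sum]
  exact Finset.sum_le_sum fun l _ =>
    hx l f (Submodule.orthogonal_le (hle l (Finset.mem_univ _)) hf)

lemma inner_rowOp (A : ι → H →L[ℂ] H) (f : PiLp 2 (fun _ : ι => H)) (g : H) :
    inner ℂ (rowOp A f) g = inner ℂ f (WithLp.toLp 2 fun l => (A l).adjoint g) := by
  rw [rowOp_apply, sum_inner, PiLp.inner_apply]
  exact Finset.sum_congr rfl fun l _ => ((A l).adjoint_inner_right _ _).symm

lemma norm_column_sq (A : ι → H →L[ℂ] H) (g : H) :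
    ‖(WithLp.toLp 2 fun l => (A l).adjoint g : PiLp 2 (fun _ : ι => H))‖ ^ 2 =
      ∑ l, ‖(A l).adjoint g‖ ^ 2 := by
  rw [PiLp.norm_sq_eq_of_L2]

/-- The bound travels from the direct sum to the row operator, to its adjoint column, to `(∑ A l)*`
and to `∑ A l`. The first and third moves drop cross terms; the other two pass to adjoints at no
cost. -/
lemma formLE_sum {A : ι → H →L[ℂ] H} {η : ℝ} (hη : 0 ≤ η) {k : ℕ}
    (h₁ : OffDiagonalLE (fun j l => (A j).adjoint ∘L A l) η k)
    (h₂ : OffDiagonalLE (fun j l => A j ∘L (A l).adjoint) η k) {c : ℝ} (hc : 0 ≤ c) {n : ι → ℕ}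
    (h : ∀ l, FormLE (fun x => ‖A l x‖ ^ 2) c (n l)) :
    FormLE (fun x => ‖(∑ l, A l) x‖ ^ 2) (c + 2 * (Fintype.card ι ^ 2 * η))
      (∑ l, n l + 2 * (Fintype.card ι ^ 2 * k)) := by
  have hrow : FormLE (fun f => ‖rowOp A f‖ ^ 2) _ _ :=
    (formLE_diagonal h).add (formLE_cross_row hη h₁) fun f => by
      linarith [le_abs_self (‖rowOp A f‖ ^ 2 - ∑ l, ‖A l (f l)‖ ^ 2)]
  have hcol := hrow.adjoint (S := (rowOp A : PiLp 2 (fun _ : ι => H) →ₗ[ℂ] H)) (inner_rowOp A)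
    (by positivity)
  have hadj : FormLE (fun g => ‖(∑ l, A l).adjoint g‖ ^ 2) _ _ :=
    hcol.add (formLE_cross_adjoint hη h₂) fun g => by
      rw [norm_column_sq]
      linarith [le_abs_self (‖(∑ l, A l).adjoint g‖ ^ 2 - ∑ l, ‖(A l).adjoint g‖ ^ 2)]
  have := hadj.adjoint (S := ((∑ l, A l).adjoint : H →ₗ[ℂ] H)) (R := fun x => (∑ l, A l) x)
    (fun x y => (∑ l, A l).adjoint_inner_left y x) (by positivity)
  exact this.mono (by linarith) (by omega)

/-- The same chain run backwards bounds the direct sum, which is then tested on the product of the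
subspaces where the `A l` are large. -/
lemma sum_le_of_formLE_sum {A : ι → H →L[ℂ] H} {η : ℝ} (hη : 0 ≤ η) {k : ℕ}
    (h₁ : OffDiagonalLE (fun j l => (A j).adjoint ∘L A l) η k)
    (h₂ : OffDiagonalLE (fun j l => A j ∘L (A l).adjoint) η k) {c : ℝ} (hc : 0 ≤ c) {m : ℕ}
    {n : ι → ℕ} (h : FormLE (fun x => ‖(∑ l, A l) x‖ ^ 2) c m)
    (hn : ∀ l, FormGT (fun x => ‖A l x‖ ^ 2) (c + 2 * (Fintype.card ι ^ 2 * η)) (n l)) :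
    ∑ l, n l ≤ m + 2 * (Fintype.card ι ^ 2 * k) := by
  have hadj := h.adjoint (S := ((∑ l, A l : H →L[ℂ] H) : H →ₗ[ℂ] H)) (R := (∑ l, A l).adjoint)
    (fun x y => ((∑ l, A l).adjoint_inner_right x y).symm) hc
  have hcol : FormLE (fun g => ‖(WithLp.toLp 2 fun l => (A l).adjoint g :
      PiLp 2 (fun _ : ι => H))‖ ^ 2) _ _ :=
    hadj.add (formLE_cross_adjoint hη h₂) fun g => by
      rw [norm_column_sq]
      linarith [neg_abs_le (‖(∑ l, A l).adjoint g‖ ^ 2 - ∑ l, ‖(A l).adjoint g‖ ^ 2)]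
  have hrow := hcol.adjoint (S := ((WithLp.linearEquiv 2 ℂ (ι → H)).symm.toLinearMap ∘ₗ
      LinearMap.pi fun l => ((A l).adjoint : H →ₗ[ℂ] H) : H →ₗ[ℂ] PiLp 2 (fun _ : ι => H)))
    (R := rowOp A) (fun x y => by
      rw [← inner_conj_symm, ← inner_conj_symm x, inner_rowOp]; rfl) (by positivity)
  have hdiag : FormLE (fun f : PiLp 2 (fun _ : ι => H) => ∑ l, ‖A l (f l)‖ ^ 2) _ _ :=
    hrow.add (formLE_cross_row hη h₁) fun f => by
      linarith [neg_abs_le (‖rowOp A f‖ ^ 2 - ∑ l, ‖A l (f l)‖ ^ 2)]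
  exact (formGT_diagonal hn).le (hdiag.mono (by linarith) (by omega))

end AlmostOrthogonal

/-! ### Upper and lower limits in `[0, ∞]` -/

section ENNRealLimits

variable {α ι : Type*} {f : Filter α}

lemma limsup_add_le_ennreal (u v : α → ℝ≥0∞) :
    limsup (fun x => u x + v x) f ≤ limsup u f + limsup v f := by
  refine ENNReal.le_of_forall_pos_le_add fun δ hδ hfin => ?_
  have hδ' : (δ / 2 : ℝ≥0∞) ≠ 0 := by simpa using hδ.ne'
  have hu : limsup u f ≠ ⊤ := (ENNReal.add_lt_top.1 hfin).1.ne
  have hv : limsup v f ≠ ⊤ := (ENNReal.add_lt_top.1 hfin).2.ne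
  refine limsup_le_of_le (h := ?_)
  filter_upwards [eventually_lt_of_limsup_lt (ENNReal.lt_add_right hu hδ'),
    eventually_lt_of_limsup_lt (ENNReal.lt_add_right hv hδ')] with x hx hy
  calc u x + v x ≤ (limsup u f + δ / 2) + (limsup v f + δ / 2) := add_le_add hx.le hy.le
    _ = limsup u f + limsup v f + (δ / 2 + δ / 2) := by ring
    _ = _ := by rw [ENNReal.add_halves]

lemma le_liminf_add_ennreal (u v : α → ℝ≥0∞) :
    liminf u f + liminf v f ≤ liminf (fun x => u x + v x) f := by
  rcases eq_or_ne (liminf u f) 0 with hu | hu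
  · rw [hu, zero_add]
    exact liminf_le_liminf (.of_forall fun x => le_add_self)
  rcases eq_or_ne (liminf v f) 0 with hv | hv
  · rw [hv, add_zero]
    exact liminf_le_liminf (.of_forall fun x => le_self_add)
  refine le_of_forall_lt_imp_le_of_dense fun c hc => ?_
  obtain ⟨a, ha, b, hb, hab⟩ := ENNReal.exists_lt_add_of_lt_add hc hu hv
  refine le_liminf_of_le (h := ?_)
  filter_upwards [eventually_lt_of_lt_liminf ha, eventually_lt_of_lt_liminf hb] with x hx hy
  exact hab.le.trans (add_le_add hx.le hy.le)

lemma limsup_sum_le_ennreal (s : Finset ι) (u : ι → α → ℝ≥0∞) :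
    limsup (fun x => ∑ i ∈ s, u i x) f ≤ ∑ i ∈ s, limsup (u i) f := by
  classical
  induction s using Finset.induction_on with
  | empty => simpa using (limsup_const_bot (α := ℝ≥0∞) (f := f)).le
  | insert a s ha ih =>
    simp only [Finset.sum_insert ha]
    exact (limsup_add_le_ennreal _ _).trans (by gcongr)

lemma le_liminf_sum_ennreal (s : Finset ι) (u : ι → α → ℝ≥0∞) :
    ∑ i ∈ s, liminf (u i) f ≤ liminf (fun x => ∑ i ∈ s, u i x) f := by
  classical
  induction s using Finset.induction_on with
  | empty => simp
  | insert a s ha ih =>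
    simp only [Finset.sum_insert ha]
    exact le_trans (by gcongr) (le_liminf_add_ennreal _ _)

lemma map_const_mul_nhdsGT_zero {a : ℝ} (ha : 0 < a) : map (fun ε => a * ε) (𝓝[>] 0) = 𝓝[>] 0 := by
  have h := (Homeomorph.mulLeft₀ a ha.ne').isEmbedding.map_nhdsWithin_eq (Set.Ioi 0) 0
  simpa [Set.image_mul_left_Ioi ha] using h

lemma limsup_comp_const_mul (u : ℝ → ℝ≥0∞) {a : ℝ} (ha : 0 < a) :
    limsup (fun ε => u (a * ε)) (𝓝[>] 0) = limsup u (𝓝[>] 0) := by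
  conv_rhs => rw [← map_const_mul_nhdsGT_zero ha]
  exact limsup_comp u (fun ε => a * ε) (𝓝[>] 0)

lemma liminf_comp_const_mul (u : ℝ → ℝ≥0∞) {a : ℝ} (ha : 0 < a) :
    liminf (fun ε => u (a * ε)) (𝓝[>] 0) = liminf u (𝓝[>] 0) := by
  conv_rhs => rw [← map_const_mul_nhdsGT_zero ha]
  exact liminf_comp u (fun ε => a * ε) (𝓝[>] 0)

lemma toENNReal_sum {ι : Type*} (s : Finset ι) (x : ι → ℕ∞) :
    ((∑ i ∈ s, x i : ℕ∞) : ℝ≥0∞) = ∑ i ∈ s, (x i : ℝ≥0∞) :=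
  map_sum ENat.toENNRealRingHom x s

lemma le_of_forall_le_rpow_mul {p : ℝ} {X Y : ℝ≥0∞}
    (h : ∀ a : ℝ, 1 < a → X ≤ ENNReal.ofReal (a ^ p) * Y) : X ≤ Y := by
  have h1 : Tendsto (fun a : ℝ => ENNReal.ofReal (a ^ p)) (𝓝[>] 1) (𝓝 1) := by
    have : Tendsto (fun a : ℝ => a ^ p) (𝓝 1) (𝓝 (1 ^ p)) :=
      (Real.continuousAt_rpow_const 1 p (.inl one_ne_zero)).tendsto
    rw [Real.one_rpow] at this
    simpa using (ENNReal.tendsto_ofReal this).mono_left nhdsWithin_le_nhds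
  have h2 := ENNReal.Tendsto.mul_const h1 (.inl one_ne_zero) (b := Y)
  rw [one_mul] at h2
  exact ge_of_tendsto h2 (by filter_upwards [self_mem_nhdsWithin] with a ha using h a ha)

end ENNRealLimits

/-! ### Asymptotics of the counting functions -/

section Asymptotics

variable {ι : Type*} [Fintype ι] {H : Type*} [NormedAddCommGroup H] [InnerProductSpace ℂ H]
  [CompleteSpace H]

/-- Needed because some counts may be infinite; then one coordinate of `n` can be taken arbitrarily
large, which forces `y = ⊤`. -/
lemma enat_sum_le_of_forall {ι : Type*} [Fintype ι] {x : ι → ℕ∞} {y : ℕ∞}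
    (h : ∀ n : ι → ℕ, (∀ i, (n i : ℕ∞) ≤ x i) → ((∑ i, n i : ℕ) : ℕ∞) ≤ y) : ∑ i, x i ≤ y := by
  by_cases hx : ∀ i, x i ≠ ⊤
  · have := h (fun i => (x i).toNat) fun i => (ENat.natCast_toNat (hx i)).le
    push_cast at this
    simpa only [ENat.natCast_toNat (hx _)] using this
  · push Not at hx
    obtain ⟨i, hi⟩ := hx
    have : y = ⊤ := ENat.eq_top_iff_forall_ge.2 fun m => by
      classical
      refine le_trans ?_ (h (fun j => if j = i then m else 0) fun j => ?_)
      · simp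
      · split_ifs with hj
        · subst hj; simp [hi]
        · simp
    simp [this]

lemma exists_offDiagonal_count {A : ι → H →L[ℂ] H}
    (h₁ : ∀ j l, j ≠ l → Rapid ((A j).adjoint ∘L A l))
    (h₂ : ∀ j l, j ≠ l → Rapid (A j ∘L (A l).adjoint)) {p τ : ℝ} (hp : 0 < p) (hτ : 0 < τ)
    (hτ1 : τ ≤ 1) : ∃ k : ℝ → ℕ,
      Tendsto (fun ε => ENNReal.ofReal (ε ^ p) * (((k ε : ℕ) : ℕ∞) : ℝ≥0∞)) (𝓝[>] 0) (𝓝 0) ∧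
      ∀ ε, 0 < ε → ε ≤ 1 → OffDiagonalLE (fun j l => (A j).adjoint ∘L A l) (τ * ε ^ 2) (k ε) ∧
        OffDiagonalLE (fun j l => A j ∘L (A l).adjoint) (τ * ε ^ 2) (k ε) := by
  let I := {i : ι × ι // i.1 ≠ i.2}
  let T : I ⊕ I → H →L[ℂ] H := Sum.elim (fun i => (A i.1.1).adjoint ∘L A i.1.2)
    (fun i => A i.1.1 ∘L (A i.1.2).adjoint)
  classical
  have hT : ∀ i, Rapid (T i) := by
    rintro (i | i)
    · exact h₁ _ _ i.2
    · exact h₂ _ _ i.2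
  -- With exponent `p / 4` at level `τ ε²`, the exceptional dimension is `O(ε^(-p/2))`, negligible
  -- against `ε^(-p)`.
  obtain ⟨C, hC0, hC⟩ := exists_common_rapid hT (q := p / 4) (by positivity)
  have hC' : ∀ ε : ℝ, ∃ k : ℕ, 0 < ε → ε ≤ 1 →
      (k : ℝ) ≤ C * (τ * ε ^ 2) ^ (-(p / 4)) ∧ ∀ i, ∃ F : Submodule ℂ H,
        FiniteDimensional ℂ F ∧ Module.finrank ℂ F ≤ k ∧
          ∀ x ∈ Fᗮ, ‖T i x‖ ≤ (τ * ε ^ 2) * ‖x‖ := fun ε => by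
    by_cases hε : 0 < ε ∧ ε ≤ 1
    · obtain ⟨k, hk⟩ := hC (τ * ε ^ 2) (by have := hε.1; positivity)
        (mul_le_one₀ hτ1 (sq_nonneg _) (pow_le_one₀ hε.1.le hε.2))
      exact ⟨k, fun _ _ => hk⟩
    · exact ⟨0, fun h1 h2 => absurd ⟨h1, h2⟩ hε⟩
  choose k hk using hC'
  refine ⟨k, ?_, fun ε hε hε1 => ⟨fun j l hjl => (hk ε hε hε1).2 (.inl ⟨(j, l), hjl⟩),
    fun j l hjl => (hk ε hε hε1).2 (.inr ⟨(j, l), hjl⟩)⟩⟩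
  have hlim : Tendsto (fun ε : ℝ => ENNReal.ofReal (C * τ ^ (-(p / 4)) * ε ^ (p / 2))) (𝓝[>] 0)
      (𝓝 0) := by
    have := (tendsto_rpow_nhdsGT_zero (p := p / 2) (by positivity)).const_mul
      (C * τ ^ (-(p / 4)))
    rw [mul_zero] at this
    simpa using ENNReal.tendsto_ofReal this
  refine tendsto_of_tendsto_of_tendsto_of_le_of_le' tendsto_const_nhds hlim
    (.of_forall fun _ => bot_le) ?_
  filter_upwards [Ioc_mem_nhdsGT one_pos] with ε hε
  have hε0 : 0 < ε := hε.1
  rw [ofReal_mul_natCast (by positivity)]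
  refine ENNReal.ofReal_le_ofReal ?_
  calc (k ε : ℝ) * ε ^ p ≤ C * (τ * ε ^ 2) ^ (-(p / 4)) * ε ^ p := by
        gcongr; exact (hk ε hε.1 hε.2).1
    _ = C * τ ^ (-(p / 4)) * ε ^ (p / 2) := by
        rw [Real.mul_rpow hτ.le (sq_nonneg _), ← Real.rpow_natCast, ← Real.rpow_mul hε0.le,
          mul_assoc, mul_assoc, mul_assoc, ← Real.rpow_add hε0]
        congr 3
        push_cast; ring

lemma exists_count_remainder {A : ι → H →L[ℂ] H}
    (h₁ : ∀ j l, j ≠ l → Rapid ((A j).adjoint ∘L A l))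
    (h₂ : ∀ j l, j ≠ l → Rapid (A j ∘L (A l).adjoint)) {p a : ℝ} (hp : 0 < p) (ha : 1 < a) :
    ∃ r : ℝ → ℕ,
      Tendsto (fun ε => ENNReal.ofReal (ε ^ p) * (((r ε : ℕ) : ℕ∞) : ℝ≥0∞)) (𝓝[>] 0) (𝓝 0) ∧
      ∀ ε, 0 < ε → ε ≤ 1 →
        singCount (∑ l, A l) (a * ε) ≤ ∑ l, singCount (A l) ε + r ε ∧
        ∑ l, singCount (A l) (a * ε) ≤ singCount (∑ l, A l) ε + r ε := by
  set D : ℝ := 2 * (Fintype.card ι : ℝ) ^ 2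
  have hD : 0 ≤ D := by positivity
  -- `D τ ≤ a² - 1` is what makes `ε²` plus the two cross-term errors at most `(a ε)²`; the `1` in
  -- `D + 1` covers an empty index set.
  set τ : ℝ := min 1 ((a ^ 2 - 1) / (D + 1))
  have ha2 : 0 < a ^ 2 - 1 := by nlinarith
  have hτ : 0 < τ := lt_min one_pos (by positivity)
  have hDτ : D * τ ≤ a ^ 2 - 1 := by
    have h1 : τ ≤ (a ^ 2 - 1) / (D + 1) := min_le_right _ _
    rw [le_div_iff₀ (by positivity)] at h1
    nlinarith
  obtain ⟨k, hk0, hk⟩ := exists_offDiagonal_count h₁ h₂ hp hτ (min_le_left _ _)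
  refine ⟨fun ε => 2 * (Fintype.card ι ^ 2 * k ε), ?_, fun ε hε hε1 => ?_⟩
  · have := ENNReal.Tendsto.const_mul (a := ((2 * Fintype.card ι ^ 2 : ℕ) : ℝ≥0∞)) hk0
      (.inr (ENNReal.natCast_ne_top _))
    rw [mul_zero] at this
    refine this.congr fun ε => ?_
    simp only [ENat.toENNReal_coe]
    push_cast
    ring
  obtain ⟨hk₁, hk₂⟩ := hk ε hε hε1
  have hη : 0 ≤ τ * ε ^ 2 := by positivity
  have hbound : ε ^ 2 + 2 * ((Fintype.card ι : ℝ) ^ 2 * (τ * ε ^ 2)) ≤ (a * ε) ^ 2 := by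
    have : D * τ * ε ^ 2 ≤ (a ^ 2 - 1) * ε ^ 2 := by gcongr
    calc _ = ε ^ 2 + D * τ * ε ^ 2 := by simp only [D]; ring
      _ ≤ _ := by nlinarith
  constructor
  · by_cases hfin : ∀ l, singCount (A l) ε ≠ ⊤
    · have h := formLE_sum hη hk₁ hk₂ (sq_nonneg ε) (n := fun l => (singCount (A l) ε).toNat)
        fun l => formLE_of_singCount_eq (ENat.natCast_toNat (hfin l)).symm
      refine (singCount_le (h.mono hbound le_rfl)).trans_eq ?_
      push_cast
      simp only [ENat.natCast_toNat (hfin _)]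
    · push Not at hfin
      obtain ⟨l, hl⟩ := hfin
      have : ∑ l, singCount (A l) ε = ⊤ :=
        top_le_iff.1 (hl.ge.trans (Finset.single_le_sum (f := fun l => singCount (A l) ε)
          (fun _ _ => bot_le) (Finset.mem_univ l)))
      simp [this]
  · refine enat_sum_le_of_forall fun n hn => ?_
    cases hm : singCount (∑ l, A l) ε with
    | top => simp
    | coe m =>
      have := sum_le_of_formLE_sum hη hk₁ hk₂ (sq_nonneg ε) (formLE_of_singCount_eq hm)
        (n := n) fun l => by
          obtain ⟨V, hV, hVn, hVx⟩ := formGT_of_le_singCount (by positivity) (hn l)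
          exact ⟨V, hV, hVn, fun x hx hx0 => lt_of_le_of_lt (by gcongr) (hVx x hx hx0)⟩
      exact_mod_cast this

/-- Sums of asymptotically orthogonal operators: the singular values of the sum behave like those
of the direct sum. -/
theorem limsup_liminf_sum_of_rapid {A : ι → H →L[ℂ] H}
    (h₁ : ∀ j l, j ≠ l → Rapid ((A j).adjoint ∘L A l))
    (h₂ : ∀ j l, j ≠ l → Rapid (A j ∘L (A l).adjoint)) {p : ℝ} (hp : 0 < p) :
    limsup (scaledSingularValue p (∑ l, A l)) atTop
        ≤ ∑ l, limsup (scaledSingularValue p (A l)) atTop ∧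
    ∑ l, liminf (scaledSingularValue p (A l)) atTop
        ≤ liminf (scaledSingularValue p (∑ l, A l)) atTop := by
  simp only [limsup_scaledSingularValue hp, liminf_scaledSingularValue hp]
  set Φ : (H →L[ℂ] H) → ℝ → ℝ≥0∞ := fun T ε =>
    ENNReal.ofReal (ε ^ p) * (singCount T ε : ℝ≥0∞) with hΦ
  have hscale : ∀ a : ℝ, 0 < a → ∀ T ε, 0 < ε → Φ T (a * ε) =
      ENNReal.ofReal (a ^ p) * (ENNReal.ofReal (ε ^ p) * (singCount T (a * ε) : ℝ≥0∞)) :=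
    fun a ha T ε hε => by
      simp only [hΦ]
      rw [Real.mul_rpow ha.le hε.le, ENNReal.ofReal_mul (by positivity), mul_assoc]
  -- It suffices to lose a factor `a^p` for each `a > 1`: rescaling `ε` by `a` does not change
  -- limits at `0⁺`.
  constructor <;> refine le_of_forall_le_rpow_mul (p := p) fun a ha => ?_
  all_goals
    obtain ⟨r, hr0, hr⟩ := exists_count_remainder h₁ h₂ hp ha
    have ha0 : 0 < a := one_pos.trans ha
  · calc limsup (Φ (∑ l, A l)) (𝓝[>] 0)
        = limsup (fun ε => Φ (∑ l, A l) (a * ε)) (𝓝[>] 0) :=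
          (limsup_comp_const_mul _ ha0).symm
      _ ≤ limsup (fun ε => ENNReal.ofReal (a ^ p) *
            (∑ l, Φ (A l) ε + ENNReal.ofReal (ε ^ p) * (((r ε : ℕ) : ℕ∞) : ℝ≥0∞))) (𝓝[>] 0) := by
          refine limsup_le_limsup ?_
          filter_upwards [Ioc_mem_nhdsGT one_pos] with ε hε
          rw [hscale a ha0 _ ε hε.1]
          gcongr
          simp only [hΦ]
          rw [← Finset.mul_sum, ← mul_add]
          gcongr
          rw [← toENNReal_sum, ← ENat.toENNReal_add]
          exact ENat.toENNReal_le.2 (hr ε hε.1 hε.2).1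
      _ = ENNReal.ofReal (a ^ p) * limsup (fun ε => ∑ l, Φ (A l) ε) (𝓝[>] 0) := by
          rw [ENNReal.limsup_const_mul_of_ne_top ENNReal.ofReal_ne_top]
          congr 1
          exact ENNReal.limsup_add_of_right_tendsto_zero hr0 _
      _ ≤ _ := by gcongr; exact limsup_sum_le_ennreal _ _
  · calc ∑ l, liminf (Φ (A l)) (𝓝[>] 0)
        = ∑ l, liminf (fun ε => Φ (A l) (a * ε)) (𝓝[>] 0) :=
          Finset.sum_congr rfl fun l _ => (liminf_comp_const_mul _ ha0).symm
      _ ≤ liminf (fun ε => ∑ l, Φ (A l) (a * ε)) (𝓝[>] 0) := le_liminf_sum_ennreal _ _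
      _ ≤ liminf (fun ε => ENNReal.ofReal (a ^ p) *
            (Φ (∑ l, A l) ε + ENNReal.ofReal (ε ^ p) * (((r ε : ℕ) : ℕ∞) : ℝ≥0∞))) (𝓝[>] 0) := by
          refine liminf_le_liminf ?_
          filter_upwards [Ioc_mem_nhdsGT one_pos] with ε hε
          simp only [hscale a ha0 _ ε hε.1]
          rw [← Finset.mul_sum, ← Finset.mul_sum]
          gcongr
          simp only [hΦ]
          rw [← mul_add]
          gcongr
          rw [← toENNReal_sum, ← ENat.toENNReal_add]
          exact ENat.toENNReal_le.2 (hr ε hε.1 hε.2).2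
      _ = ENNReal.ofReal (a ^ p) * liminf (Φ (∑ l, A l)) (𝓝[>] 0) := by
          rw [ENNReal.liminf_const_mul_of_ne_zero_of_ne_top
            (by simpa using Real.rpow_pos_of_pos ha0 p) ENNReal.ofReal_ne_top]
          congr 1
          exact ENNReal.liminf_add_of_right_tendsto_zero hr0 _

end Asymptotics

/-! ### Trigonometric approximation of smooth functions -/

section SmoothApproximation

/-- Smoothness of a function on the circle, in the angular variable. -/
def IsSmooth (g : C(Torus, ℂ)) : Prop := ContDiff ℝ (⊤ : ℕ∞) fun s : ℝ => g (s : Torus)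

lemma norm_fourierCoeffOn_le (f : ℝ → ℂ) (n : ℤ) :
    ‖fourierCoeffOn (zero_lt_one (α := ℝ)) f n‖ ≤ ∫ x in (0 : ℝ)..1, ‖f x‖ := by
  rw [fourierCoeffOn_eq_integral]
  simp only [sub_zero, div_one, one_smul]
  refine (intervalIntegral.norm_integral_le_integral_norm zero_le_one).trans_eq ?_
  congr 1 with x
  rw [norm_smul, fourier_apply, Circle.norm_coe, one_mul]

/-- Integration by parts `M` times; periodicity removes the boundary terms. -/
lemma exists_fourierCoeffOn_le (M : ℕ) (f : ℝ → ℂ) (hf : ContDiff ℝ (⊤ : ℕ∞) f)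
    (hper : Function.Periodic f 1) :
    ∃ C : ℝ, ∀ n : ℤ, n ≠ 0 →
      ‖fourierCoeffOn (zero_lt_one (α := ℝ)) f n‖ ≤ C / |(n : ℝ)| ^ M := by
  induction M generalizing f with
  | zero => exact ⟨∫ x in (0 : ℝ)..1, ‖f x‖, fun n _ => by simpa using norm_fourierCoeffOn_le f n⟩
  | succ M ih =>
    obtain ⟨hd, hd'⟩ := contDiff_infty_iff_deriv.1 hf
    have hper' : Function.Periodic (deriv f) 1 := fun x => by
      rw [← deriv_comp_add_const f 1 x]
      exact congrArg (fun g => deriv g x) (funext hper)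
    obtain ⟨C, hC⟩ := ih (deriv f) hd' hper'
    refine ⟨C, fun n hn => ?_⟩
    have hn' : 0 < |(n : ℝ)| := by simpa using hn
    rw [fourierCoeffOn_of_hasDerivAt zero_lt_one hn (fun x _ => (hd x).hasDerivAt)
      (hd'.continuous.intervalIntegrable _ _)]
    have h01 : f 1 - f 0 = 0 := by simpa [sub_eq_zero] using hper 0
    rw [h01]
    simp only [mul_zero, zero_sub, Complex.ofReal_one, Complex.ofReal_zero, sub_zero, one_mul,
      mul_neg, norm_neg, norm_mul, norm_div, norm_one, Complex.norm_I, mul_one, Complex.norm_ofNat,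
      Complex.norm_real, Complex.norm_intCast, Real.norm_eq_abs, abs_of_pos Real.pi_pos]
    calc 1 / (2 * Real.pi * |(n : ℝ)|) * ‖fourierCoeffOn _ (deriv f) n‖
        ≤ 1 / |(n : ℝ)| * (C / |(n : ℝ)| ^ M) := by
          gcongr
          · exact le_mul_of_one_le_left hn'.le (by linarith [Real.pi_gt_three])
          · exact hC n hn
      _ = C / |(n : ℝ)| ^ (M + 1) := by rw [div_mul_div_comm, one_mul, pow_succ']

lemma fourierCoeff_eq_fourierCoeffOn (g : Torus → ℂ) (n : ℤ) :
    fourierCoeff g n = fourierCoeffOn (zero_lt_one (α := ℝ)) (fun s : ℝ => g (s : Torus)) n := by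
  rw [fourierCoeff_eq_intervalIntegral g n 0, fourierCoeffOn_eq_integral]
  simp

lemma exists_fourierCoeff_le {g : C(Torus, ℂ)} (hg : IsSmooth g) (M : ℕ) :
    ∃ C : ℝ, 0 ≤ C ∧ ∀ n : ℤ, n ≠ 0 → ‖fourierCoeff g n‖ ≤ C / |(n : ℝ)| ^ M := by
  obtain ⟨C, hC⟩ := exists_fourierCoeffOn_le M _ hg fun s => by simp
  refine ⟨C, ?_, fun n hn => ?_⟩
  · have := (norm_nonneg _).trans (hC 1 one_ne_zero)
    simpa using this
  · rw [fourierCoeff_eq_fourierCoeffOn]; exact hC n hn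

/-- Trigonometric polynomials of degree at most `k`. -/
def trigPoly (k : ℕ) : Submodule ℂ C(Torus, ℂ) :=
  Submodule.span ℂ ((fun n : ℤ => (fourier n : C(Torus, ℂ))) '' {n | |n| ≤ (k : ℤ)})

lemma exists_trigPoly_approx {g : C(Torus, ℂ)} (hg : IsSmooth g) (M : ℕ) :
    ∃ D : ℝ, ∀ k : ℕ, ∃ P ∈ trigPoly k, ‖g - P‖ ≤ D / ((k : ℝ) + 1) ^ M := by
  -- Two of the `M + 2` powers make the tail summable; the other `M` give the rate.
  obtain ⟨C, hC0, hC⟩ := exists_fourierCoeff_le hg (M + 2)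
  have hsum2 : Summable fun n : ℤ => 1 / |(n : ℝ)| ^ 2 := by
    simpa using Real.summable_one_div_int_pow.2 one_lt_two
  have hle : ∀ k : ℕ, ∀ n : ℤ, (k : ℤ) < |n| →
      ‖fourierCoeff g n‖ ≤ (C / ((k : ℝ) + 1) ^ M) * (1 / |(n : ℝ)| ^ 2) := fun k n hn => by
    have hk : (k : ℝ) + 1 ≤ |(n : ℝ)| := by exact_mod_cast hn
    have hn0 : n ≠ 0 := by rintro rfl; simp at hn; omega
    have hn' : 0 < |(n : ℝ)| := by simpa using hn0
    calc _ ≤ C / |(n : ℝ)| ^ (M + 2) := hC n hn0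
      _ = C / |(n : ℝ)| ^ M * (1 / |(n : ℝ)| ^ 2) := by rw [pow_add]; field_simp
      _ ≤ _ := by gcongr
  have hsum : Summable (fourierCoeff g) := by
    refine .of_norm_bounded_eventually (hsum2.mul_left (C / (((0 : ℕ) : ℝ) + 1) ^ M)) ?_
    filter_upwards [(Set.finite_singleton (0 : ℤ)).compl_mem_cofinite] with n hn
    exact hle 0 n (by simpa using hn)
  have hhas := hasSum_fourier_series_of_summable hsum
  refine ⟨C * ∑' n : ℤ, 1 / |(n : ℝ)| ^ 2, fun k => ?_⟩
  set s : Finset ℤ := Finset.Icc (-k) k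
  refine ⟨∑ n ∈ s, fourierCoeff g n • fourier n, Submodule.sum_mem _ fun n hn =>
    Submodule.smul_mem _ _ (Submodule.subset_span ⟨n, ?_, rfl⟩), ?_⟩
  · simpa [abs_le, s] using hn
  · have h1 : HasSum (fun n : {n // n ∉ s} => fourierCoeff g n • (fourier n : C(Torus, ℂ)))
        (g - ∑ n ∈ s, fourierCoeff g n • fourier n) := by
      refine (Finset.hasSum_compl_iff
        (f := fun n : ℤ => fourierCoeff g n • (fourier n : C(Torus, ℂ))) s).2 ?_
      rw [sub_add_cancel]
      exact hhas
    have h2 : ∀ n : {n // n ∉ s}, ‖fourierCoeff g n • (fourier n : C(Torus, ℂ))‖ ≤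
        (C / ((k : ℝ) + 1) ^ M) * (1 / |((n : ℤ) : ℝ)| ^ 2) := fun n => by
      rw [norm_smul, fourier_norm, mul_one]
      refine hle k n ?_
      have := n.2
      simp only [s, Finset.mem_Icc, ← abs_le, not_le] at this
      exact this
    have h3 : Summable fun n : {n // n ∉ s} =>
        (C / ((k : ℝ) + 1) ^ M) * (1 / |((n : ℤ) : ℝ)| ^ 2) :=
      (hsum2.mul_left _).comp_injective Subtype.val_injective
    have h4 : ∑' n : {n // n ∉ s}, 1 / |((n : ℤ) : ℝ)| ^ 2 ≤ ∑' n : ℤ, 1 / |(n : ℝ)| ^ 2 :=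
      hsum2.tsum_subtype_le _ {n | n ∉ s} (fun _ => by positivity)
    calc _ ≤ ∑' n : {n // n ∉ s}, (C / ((k : ℝ) + 1) ^ M) * (1 / |((n : ℤ) : ℝ)| ^ 2) :=
          h1.norm_le_of_bounded h3.hasSum h2
      _ = (C / ((k : ℝ) + 1) ^ M) * ∑' n : {n // n ∉ s}, 1 / |((n : ℤ) : ℝ)| ^ 2 :=
          tsum_mul_left
      _ ≤ (C / ((k : ℝ) + 1) ^ M) * ∑' n : ℤ, 1 / |(n : ℝ)| ^ 2 := by gcongr
      _ = _ := by ring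

lemma exists_trigPoly_rapid {g : C(Torus, ℂ)} (hg : IsSmooth g) {q : ℝ} (hq : 0 < q) :
    ∃ C : ℝ, ∀ ε : ℝ, 0 < ε → ε ≤ 1 → ∃ k : ℕ, (2 * k + 1 : ℝ) ≤ C * ε ^ (-q) ∧
      ∃ P ∈ trigPoly k, ‖g - P‖ ≤ ε := by
  obtain ⟨M, hM⟩ := exists_nat_gt (1 / q)
  have hM0 : (0 : ℝ) < M := (by positivity : (0 : ℝ) < 1 / q).trans hM
  have hMq : (M : ℝ)⁻¹ ≤ q := by
    rw [div_lt_iff₀ hq] at hM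
    rw [inv_le_iff_one_le_mul₀ hM0]; linarith
  obtain ⟨D, hD⟩ := exists_trigPoly_approx hg M
  set D' := max D 1
  have hD1 : 1 ≤ D' := le_max_right _ _
  have hD0 : 0 < D' := one_pos.trans_le hD1
  refine ⟨3 * D' ^ (M : ℝ)⁻¹, fun ε hε hε1 => ?_⟩
  -- The degree is `⌊y⌋`, where `y` solves `D' / y^M = ε`. Since `M > 1 / q`, `y` is `O(ε^(-q))`,
  -- and `y ≥ 1` gives `2 ⌊y⌋ + 1 ≤ 3 y`.
  set y : ℝ := (D' / ε) ^ (M : ℝ)⁻¹ with hy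
  have hDε : 1 ≤ D' / ε := (one_le_div hε).2 (hε1.trans hD1)
  have hy1 : 1 ≤ y := Real.one_le_rpow hDε (by positivity)
  have hyM : y ^ M = D' / ε := Real.rpow_inv_natCast_pow (by positivity) (by
    rintro rfl; simp at hM0)
  have hyle : y ≤ D' ^ (M : ℝ)⁻¹ * ε ^ (-q) := by
    rw [hy, Real.div_rpow hD0.le hε.le, div_eq_mul_inv, ← Real.rpow_neg hε.le]
    gcongr 1
    exact Real.rpow_le_rpow_of_exponent_ge hε hε1 (by linarith)
  refine ⟨⌊y⌋₊, ?_, ?_⟩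
  · have := Nat.floor_le (zero_le_one.trans hy1)
    linarith
  · obtain ⟨P, hP, hle⟩ := hD ⌊y⌋₊
    refine ⟨P, hP, hle.trans ?_⟩
    have h1 : y ≤ (⌊y⌋₊ : ℝ) + 1 := (Nat.lt_floor_add_one y).le
    rw [div_le_iff₀ (by positivity)]
    calc D ≤ D' := le_max_left _ _
      _ = ε * y ^ M := by rw [hyM]; field_simp
      _ ≤ _ := by gcongr

end SmoothApproximation

/-! ### Commutators with the Riesz projection and Hankel operators -/

section Operators

/-- Multiplication by a continuous function on `L²(𝕋)`. -/
def mulCont : C(Torus, ℂ) →L[ℂ] L2 →L[ℂ] L2 :=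
  (ContinuousLinearMap.mul ℂ ℂ).holderL m ∞ 2 2 ∘L ContinuousMap.toLp ∞ m ℂ

/-- The Riesz projection, as an operator on `L²(𝕋)`. -/
def riesz : L2 →L[ℂ] L2 := hardySubspace.starProjection

lemma coeFn_mulOp (ω : LInfty) (f : L2) : mulOp ω f =ᵐ[m] fun θ => ω θ * f θ :=
  ContinuousLinearMap.coeFn_holder (r := 2) (ContinuousLinearMap.mul ℂ ℂ) ω f

lemma coeFn_mulCont (g : C(Torus, ℂ)) (f : L2) : mulCont g f =ᵐ[m] fun θ => g θ * f θ := by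
  have h1 := coeFn_mulOp (ContinuousMap.toLp ∞ m ℂ g) f
  filter_upwards [h1, ContinuousMap.coeFn_toLp (p := ∞) (𝕜 := ℂ) m g] with θ hθ hg
  rw [← hg]
  exact hθ

lemma coeFn_reflection (f : L2) : reflection f =ᵐ[m] fun θ => f (-θ) :=
  Lp.coeFn_compMeasurePreserving f (Measure.measurePreserving_neg m)

lemma ext_fourierCoeff {f g : L2} (h : ∀ i, fourierCoeff f i = fourierCoeff g i) : f = g := by
  apply fourierBasis.repr.injective
  ext i
  rw [fourierBasis_repr, fourierBasis_repr, h]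

lemma fourierCoeff_eq_inner (f : L2) (i : ℤ) :
    fourierCoeff f i = inner ℂ (fourierLp 2 i : L2) f := by
  rw [← fourierBasis_repr, HilbertBasis.repr_apply_apply, coe_fourierBasis]

lemma fourierCoeff_mulCont_fourier (n : ℤ) (f : L2) (i : ℤ) :
    fourierCoeff (mulCont (fourier n) f) i = fourierCoeff f (i - n) := by
  rw [fourierCoeff_congr_ae (coeFn_mulCont (fourier n) f)]
  unfold fourierCoeff
  congr 1 with θ
  rw [show -(i - n) = -i + n by ring, fourier_add, smul_eq_mul, smul_eq_mul, mul_assoc]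

lemma fourierCoeff_reflection (f : L2) (i : ℤ) :
    fourierCoeff (reflection f) i = fourierCoeff f (-i) := by
  rw [fourierCoeff_congr_ae (coeFn_reflection f)]
  unfold fourierCoeff
  rw [← integral_neg_eq_self]
  congr 1 with θ
  simp only [neg_neg, fourier_apply, smul_neg, neg_smul]

lemma fourierLp_mem_hardySubspace {i : ℤ} (hi : 0 ≤ i) : (fourierLp 2 i : L2) ∈ hardySubspace :=
  Submodule.le_topologicalClosure _ (Submodule.subset_span ⟨i.toNat, by simp [hi]⟩)

lemma fourierCoeff_of_mem_hardySubspace {f : L2} (hf : f ∈ hardySubspace) {i : ℤ} (hi : i < 0) :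
    fourierCoeff f i = 0 := by
  have hle : hardySubspace ≤ (Submodule.span ℂ {(fourierLp 2 i : L2)})ᗮ := by
    refine Submodule.topologicalClosure_minimal _ ?_ (Submodule.isClosed_orthogonal _)
    rw [Submodule.span_le]
    rintro _ ⟨n, rfl⟩
    rw [SetLike.mem_coe, Submodule.mem_orthogonal_singleton_iff_inner_right]
    exact orthonormal_fourier.inner_eq_zero (by omega)
  rw [fourierCoeff_eq_inner]
  exact Submodule.mem_orthogonal_singleton_iff_inner_right.1 (hle hf)

lemma fourierCoeff_riesz (f : L2) (i : ℤ) :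
    fourierCoeff (riesz f) i = if 0 ≤ i then fourierCoeff f i else 0 := by
  split_ifs with hi
  · rw [fourierCoeff_eq_inner, fourierCoeff_eq_inner, riesz,
      ← Submodule.inner_starProjection_left_eq_right,
      Submodule.starProjection_eq_self_iff.2 (fourierLp_mem_hardySubspace hi)]
  · exact fourierCoeff_of_mem_hardySubspace (Submodule.starProjection_apply_mem _ _) (not_le.1 hi)

/-- The commutator of multiplication by `g` with the Riesz projection. -/
def rieszComm (g : C(Torus, ℂ)) : L2 →L[ℂ] L2 := mulCont g ∘L riesz - riesz ∘L mulCont g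

lemma rieszComm_apply (g : C(Torus, ℂ)) (f : L2) :
    rieszComm g f = mulCont g (riesz f) - riesz (mulCont g f) := rfl

/-- A shift by at most `k` cannot carry a frequency of modulus above `k` across the cut between
negative and nonnegative frequencies, so truncation and shift commute. -/
lemma rieszComm_fourier_eq_zero {k : ℕ} {n : ℤ} (hn : |n| ≤ k) {f : L2}
    (hf : ∀ j : ℤ, |j| ≤ k → fourierCoeff f j = 0) : rieszComm (fourier n) f = 0 := by
  rw [rieszComm_apply, sub_eq_zero]
  refine ext_fourierCoeff fun i => ?_
  rw [fourierCoeff_mulCont_fourier, fourierCoeff_riesz, fourierCoeff_riesz,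
    fourierCoeff_mulCont_fourier]
  by_cases hj : |i - n| ≤ k
  · simp [hf _ hj]
  · rw [abs_le] at hn hj
    have : 0 ≤ i - n ↔ 0 ≤ i := by omega
    simp only [this]

lemma rieszComm_trigPoly_eq_zero {k : ℕ} {P : C(Torus, ℂ)} (hP : P ∈ trigPoly k) {f : L2}
    (hf : ∀ j : ℤ, |j| ≤ k → fourierCoeff f j = 0) : rieszComm P f = 0 := by
  induction hP using Submodule.span_induction with
  | mem x hx =>
    obtain ⟨n, hn, rfl⟩ := hx
    exact rieszComm_fourier_eq_zero hn hf
  | zero => simp [rieszComm_apply]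
  | add x y _ _ hx hy =>
    have : rieszComm (x + y) f = rieszComm x f + rieszComm y f := by
      simp only [rieszComm_apply, map_add, add_apply]; abel
    rw [this, hx, hy, add_zero]
  | smul a x _ hx =>
    have : rieszComm (a • x) f = a • rieszComm x f := by
      simp [rieszComm_apply, smul_sub]
    rw [this, hx, smul_zero]

/-- The span of the exponentials of frequency at most `k` in absolute value. -/
def lowFreq (k : ℕ) : Submodule ℂ L2 :=
  Submodule.span ℂ (Set.range fun j : Finset.Icc (-k : ℤ) k => (fourierLp 2 (j : ℤ) : L2))

instance (k : ℕ) : FiniteDimensional ℂ (lowFreq k) :=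
  FiniteDimensional.span_of_finite ℂ (Set.finite_range _)

lemma finrank_lowFreq_le (k : ℕ) : Module.finrank ℂ (lowFreq k) ≤ 2 * k + 1 := by
  refine (finrank_range_le_card (R := ℂ)
    fun j : Finset.Icc (-k : ℤ) k => (fourierLp 2 (j : ℤ) : L2)).trans ?_
  rw [Fintype.card_coe, Int.card_Icc]
  omega

lemma fourierCoeff_eq_zero_of_mem_lowFreq_orthogonal {k : ℕ} {f : L2} (hf : f ∈ (lowFreq k)ᗮ)
    {j : ℤ} (hj : |j| ≤ k) : fourierCoeff f j = 0 := by
  rw [fourierCoeff_eq_inner]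
  refine Submodule.inner_right_of_mem_orthogonal (Submodule.subset_span ?_) hf
  rw [abs_le] at hj
  exact ⟨⟨j, Finset.mem_Icc.2 hj⟩, rfl⟩

lemma rapid_rieszComm {g : C(Torus, ℂ)} (hg : IsSmooth g) : Rapid (rieszComm g) := by
  refine Rapid.of_le (‖mulCont‖ * ‖riesz‖ + ‖riesz‖ * ‖mulCont‖) fun q hq => ?_
  obtain ⟨C, hC⟩ := exists_trigPoly_rapid hg hq
  refine ⟨C, fun ε hε hε1 => ?_⟩
  obtain ⟨k, hk, P, hP, hPε⟩ := hC ε hε hε1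
  refine ⟨lowFreq k, inferInstance, le_trans ?_ hk, fun f hf => ?_⟩
  · exact_mod_cast finrank_lowFreq_le k
  have h0 := rieszComm_trigPoly_eq_zero hP fun j hj =>
    fourierCoeff_eq_zero_of_mem_lowFreq_orthogonal hf hj
  have h1 : rieszComm g f = mulCont (g - P) (riesz f) - riesz (mulCont (g - P) f) := by
    rw [← sub_zero (rieszComm g f), ← h0]
    simp only [rieszComm_apply, map_sub, sub_apply]; abel
  have hmul : ∀ f : L2, ‖mulCont (g - P) f‖ ≤ ‖mulCont‖ * ε * ‖f‖ := fun f =>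
    (mulCont (g - P)).le_of_opNorm_le ((mulCont.le_opNorm _).trans (by gcongr)) f
  rw [h1]
  calc _ ≤ ‖mulCont (g - P) (riesz f)‖ + ‖riesz (mulCont (g - P) f)‖ := norm_sub_le _ _
    _ ≤ ‖mulCont‖ * ε * (‖riesz‖ * ‖f‖) + ‖riesz‖ * (‖mulCont‖ * ε * ‖f‖) := by
      refine add_le_add ((hmul _).trans ?_) ((riesz.le_opNorm _).trans ?_)
      · gcongr; exact riesz.le_opNorm f
      · gcongr; exact hmul f
    _ = _ := by ring

/-- Frequency `0` is the only nonnegative one whose reflection is nonnegative, so `P W P` vanishes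
off the constants. -/
lemma rapid_riesz_reflection_riesz : Rapid (riesz ∘L reflection ∘L riesz) := by
  intro q hq
  refine ⟨1, fun ε hε hε1 => ⟨lowFreq 0, inferInstance, ?_, fun f hf => ?_⟩⟩
  · have h1 : (Module.finrank ℂ (lowFreq 0) : ℝ) ≤ 1 := by exact_mod_cast finrank_lowFreq_le 0
    rw [one_mul]
    exact h1.trans (Real.one_le_rpow_of_pos_of_le_one_of_nonpos hε hε1 (by linarith))
  · have h0 : (riesz ∘L reflection ∘L riesz) f = 0 := by
      refine ext_fourierCoeff fun i => ?_
      have hz : fourierCoeff ((0 : L2) : Torus → ℂ) i = 0 := by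
        rw [fourierCoeff_eq_inner, inner_zero_right]
      rw [hz]
      simp only [ContinuousLinearMap.comp_apply]
      rw [fourierCoeff_riesz, fourierCoeff_reflection, fourierCoeff_riesz]
      split_ifs with h1 h2
      · obtain rfl : i = 0 := by omega
        exact fourierCoeff_eq_zero_of_mem_lowFreq_orthogonal hf (by simp)
      · rfl
      · rfl
    rw [h0]
    simp only [norm_zero]
    positivity

/-- The compression `P₊ B W` of an operator `B` on `L²(𝕋)` to the Hardy space. -/
def hankelOf (B : L2 →L[ℂ] L2) : H2 →L[ℂ] H2 :=
  hardySubspace.orthogonalProjectionOnto ∘L B ∘L reflection ∘L hardySubspace.subtypeL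

lemma riesz_coe (f : H2) : riesz (f : L2) = f := Submodule.starProjection_mem_subspace_eq_self f

lemma coe_orthogonalProjectionOnto (f : L2) :
    (hardySubspace.orthogonalProjectionOnto f : L2) = riesz f := rfl

lemma orthogonalProjectionOnto_riesz (f : L2) :
    hardySubspace.orthogonalProjectionOnto (riesz f) =
      hardySubspace.orthogonalProjectionOnto f := by
  apply Subtype.ext
  rw [coe_orthogonalProjectionOnto, coe_orthogonalProjectionOnto, ← coe_orthogonalProjectionOnto f,
    riesz_coe]

lemma rapid_hankelOf_mulCont {g : C(Torus, ℂ)} (hg : IsSmooth g) : Rapid (hankelOf (mulCont g)) := by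
  -- On the Hardy space `P g W P = -[g, P] W P + g P W P`.
  have h1 : Rapid (rieszComm g ∘L ((-1 : ℂ) • reflection ∘L riesz)) :=
    (rapid_rieszComm hg).comp_right _
  have h2 : Rapid (mulCont g ∘L (riesz ∘L reflection ∘L riesz)) :=
    rapid_riesz_reflection_riesz.comp_left _
  have h3 := ((h1.add h2).comp_right hardySubspace.subtypeL).comp_left
    hardySubspace.orthogonalProjectionOnto
  convert h3 using 1
  ext f : 1
  simp only [hankelOf, ContinuousLinearMap.comp_apply, add_apply, neg_smul, one_smul,
    map_neg, neg_apply, rieszComm_apply, Submodule.subtypeL_apply, riesz_coe, neg_sub,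
    map_add, map_sub, orthogonalProjectionOnto_riesz]
  abel

lemma mulOp_mulCont_comm (ω : LInfty) (g : C(Torus, ℂ)) (f : L2) :
    mulOp ω (mulCont g f) = mulCont g (mulOp ω f) := by
  apply Lp.ext
  filter_upwards [coeFn_mulOp ω (mulCont g f), coeFn_mulCont g f, coeFn_mulCont g (mulOp ω f),
    coeFn_mulOp ω f] with θ h1 h2 h3 h4
  rw [h1, h2, h3, h4]; ring

lemma reflection_reflection (f : L2) : reflection (reflection f) = f :=
  ext_fourierCoeff fun i => by rw [fourierCoeff_reflection, fourierCoeff_reflection, neg_neg]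

lemma inner_reflection (f g : L2) : inner ℂ (reflection f) g = inner ℂ f (reflection g) := by
  have h : ∀ f g : L2, inner ℂ (reflection f) (reflection g) = inner ℂ f g := fun f g =>
    LinearIsometry.inner_map_map (𝕜 := ℂ) (Lp.compMeasurePreservingₗᵢ ℂ (fun θ : Torus => -θ)
      (Measure.measurePreserving_neg m) : L2 →ₗᵢ[ℂ] L2) f g
  rw [← h f (reflection g), reflection_reflection]

lemma adjoint_reflection : reflection.adjoint = reflection :=
  ((ContinuousLinearMap.eq_adjoint_iff _ _).2 inner_reflection).symm

lemma adjoint_mulCont {g : C(Torus, ℂ)} (hg : ∀ θ, star (g θ) = g θ) :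
    (mulCont g).adjoint = mulCont g := by
  refine ((ContinuousLinearMap.eq_adjoint_iff _ _).2 fun f h => ?_).symm
  rw [L2.inner_def, L2.inner_def]
  refine integral_congr_ae ?_
  filter_upwards [coeFn_mulCont g f, coeFn_mulCont g h] with θ h1 h2
  have := hg θ
  rw [h1, h2]
  simp only [RCLike.inner_apply, map_mul]
  rw [starRingEnd_apply, this]; ring

/-- The function `θ ↦ g (-θ)`. -/
def flip (g : C(Torus, ℂ)) : C(Torus, ℂ) := ⟨fun θ => g (-θ), by fun_prop⟩

lemma IsSmooth.flip {g : C(Torus, ℂ)} (hg : IsSmooth g) : IsSmooth (flip g) := by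
  have : ContDiff ℝ (⊤ : ℕ∞) fun s : ℝ => g ((-s : ℝ) : Torus) := hg.comp contDiff_neg
  simpa [IsSmooth, HankelLocalization.flip] using this

lemma reflection_mulCont (g : C(Torus, ℂ)) (f : L2) :
    reflection (mulCont g f) = mulCont (flip g) (reflection f) := by
  apply Lp.ext
  have h0 := (Measure.measurePreserving_neg m).quasiMeasurePreserving.ae (coeFn_mulCont g f)
  filter_upwards [coeFn_reflection (mulCont g f), h0, coeFn_mulCont (flip g) (reflection f),
    coeFn_reflection f] with θ h1 h2 h3 h4
  rw [h1, h2, h3, h4]; rfl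

lemma mulCont_reflection (g : C(Torus, ℂ)) (f : L2) :
    mulCont g (reflection f) = reflection (mulCont (flip g) f) := by
  rw [reflection_mulCont]
  congr 2
  ext θ; simp [flip]

lemma hankelOf_adjoint_apply (B : L2 →L[ℂ] L2) (f : H2) :
    (hankelOf B).adjoint f =
      hardySubspace.orthogonalProjectionOnto (reflection (B.adjoint (f : L2))) := by
  simp only [hankelOf, ContinuousLinearMap.adjoint_comp, Submodule.adjoint_subtypeL,
    Submodule.adjoint_orthogonalProjectionOnto, adjoint_reflection, ContinuousLinearMap.comp_apply,
    Submodule.subtypeL_apply]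

/-- If a smooth real cutoff `φ` splits `B₁` and `B₂` into a smooth part and a rest, with the rests
on opposite sides of the cutoff, then the two Hankel operators are asymptotically orthogonal. -/
lemma rapid_adjoint_comp {φ s₁ s₂ : C(Torus, ℂ)} (hφ : IsSmooth φ) (hφr : ∀ θ, star (φ θ) = φ θ)
    (hs₁ : IsSmooth s₁) (hs₂ : IsSmooth s₂) {B₁ B₂ : L2 →L[ℂ] L2}
    (hB₁ : B₁ = mulCont φ ∘L B₁ + mulCont s₁) (hB₂ : mulCont φ ∘L B₂ = mulCont s₂) :
    Rapid ((hankelOf B₁).adjoint ∘L hankelOf B₂) := by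
  -- Writing `B₁* = B₁* φ + s₁*` and `φ P B₂ = [φ, P] B₂ + P s₂` splits the product into three rapid
  -- terms.
  have h1 : Rapid (hardySubspace.orthogonalProjectionOnto ∘L reflection ∘L B₁.adjoint ∘L
      rieszComm φ ∘L (B₂ ∘L reflection ∘L hardySubspace.subtypeL)) :=
    ((((rapid_rieszComm hφ).comp_right _).comp_left _).comp_left _).comp_left _
  have h2 : Rapid ((hankelOf B₁).adjoint ∘L hankelOf (mulCont s₂)) :=
    (rapid_hankelOf_mulCont hs₂).comp_left _
  have h3 : Rapid ((hankelOf (mulCont s₁)).adjoint ∘L hankelOf B₂) :=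
    (rapid_hankelOf_mulCont hs₁).adjoint.comp_right _
  convert (h1.add h2).add h3 using 1
  have hadj : ∀ f, B₁.adjoint f = B₁.adjoint (mulCont φ f) + (mulCont s₁).adjoint f := fun f => by
    conv_lhs => rw [hB₁]
    rw [map_add, ContinuousLinearMap.adjoint_comp, adjoint_mulCont hφr]
    rfl
  have hs₂' : ∀ f, mulCont s₂ f = mulCont φ (B₂ f) := fun f => by rw [← hB₂]; rfl
  ext f : 1
  simp only [ContinuousLinearMap.comp_apply, add_apply, hankelOf_adjoint_apply]
  rw [← map_add, ← map_add, ← map_add, ← map_add]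
  congr 2
  simp only [hankelOf, ContinuousLinearMap.comp_apply, coe_orthogonalProjectionOnto,
    rieszComm_apply, map_sub, Submodule.subtypeL_apply]
  rw [hadj, hs₂', sub_add_cancel]

/-- In `P B₁ W P W B₂*` the cutoff passes from `B₁` to `B₂*` through both reflections. Between them
it becomes its flip, whose commutator with `P` is rapid; beyond them `φ B₂* = s₂*`. Commutation with
`φ` puts the cutoff on the inner side of each `B`. -/
lemma rapid_comp_adjoint {φ s₁ s₂ : C(Torus, ℂ)} (hφ : IsSmooth φ) (hφr : ∀ θ, star (φ θ) = φ θ)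
    (hs₁ : IsSmooth s₁) (hs₂ : IsSmooth s₂) {B₁ B₂ : L2 →L[ℂ] L2}
    (hcomm : ∀ f, B₁ (mulCont φ f) = mulCont φ (B₁ f))
    (hcomm₂ : ∀ f, B₂ (mulCont φ f) = mulCont φ (B₂ f))
    (hB₁ : B₁ = mulCont φ ∘L B₁ + mulCont s₁) (hB₂ : mulCont φ ∘L B₂ = mulCont s₂) :
    Rapid (hankelOf B₁ ∘L (hankelOf B₂).adjoint) := by
  have h1 : Rapid (hardySubspace.orthogonalProjectionOnto ∘L B₁ ∘L reflection ∘L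
      rieszComm (flip φ) ∘L (reflection ∘L B₂.adjoint ∘L hardySubspace.subtypeL)) :=
    ((((rapid_rieszComm hφ.flip).comp_right _).comp_left _).comp_left _).comp_left _
  have h2 : Rapid (hankelOf B₁ ∘L (hankelOf (mulCont s₂)).adjoint) :=
    (rapid_hankelOf_mulCont hs₂).adjoint.comp_left _
  have h3 : Rapid (hankelOf (mulCont s₁) ∘L (hankelOf B₂).adjoint) :=
    (rapid_hankelOf_mulCont hs₁).comp_right _
  convert (h1.add h2).add h3 using 1
  have hB₁' : ∀ f, B₁ f = B₁ (mulCont φ f) + mulCont s₁ f := fun f => by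
    conv_lhs => rw [hB₁]
    rw [hcomm]; rfl
  have hs₂' : ∀ f, (mulCont s₂).adjoint f = mulCont φ (B₂.adjoint f) := fun f => by
    have : mulCont s₂ = B₂ ∘L mulCont φ := by
      rw [← hB₂]; ext1 f; exact (hcomm₂ f).symm
    rw [this, ContinuousLinearMap.adjoint_comp, adjoint_mulCont hφr]; rfl
  ext f : 1
  simp only [ContinuousLinearMap.comp_apply, add_apply, hankelOf_adjoint_apply]
  simp only [hankelOf, ContinuousLinearMap.comp_apply, coe_orthogonalProjectionOnto,
    rieszComm_apply, map_sub, Submodule.subtypeL_apply, hs₂']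
  rw [hB₁', mulCont_reflection, reflection_mulCont φ, map_add]
  abel

end Operators

/-! ### Singular supports, cutoffs and localization -/

section SingularSupport

lemma continuousAt_of_lift {g : Torus → ℂ} {t : ℝ}
    (h : ContinuousAt (fun s : ℝ => g (s : Torus)) t) : ContinuousAt g (t : Torus) :=
  (QuotientAddGroup.isOpenQuotientMap_mk
    (N := AddSubgroup.zmultiples (1 : ℝ))).continuousAt_comp_iff.1 h

lemma continuousOn_of_smooth {g : Torus → ℂ} {X : Set Torus}
    (h : ∀ t : ℝ, (t : Torus) ∉ X → ContDiffAt ℝ (⊤ : ℕ∞) (fun s : ℝ => g (s : Torus)) t) :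
    ContinuousOn g Xᶜ := fun θ hθ => by
  obtain ⟨t, rfl⟩ := QuotientAddGroup.mk_surjective θ
  exact (continuousAt_of_lift (h t hθ).continuousAt).continuousWithinAt

lemma isClosed_singSupp (ω : LInfty) : IsClosed (singSupp ω) := isClosed_sInter fun _ h => h.1

lemma continuous_coe_torus : Continuous fun s : ℝ => (s : Torus) :=
  AddCircle.continuous_mk' 1

/-- The symbol is smooth off its singular support. -/
lemma isSmoothOff_singSupp (ω : LInfty) : IsSmoothOff ω (singSupp ω) := by
  classical
  set S : Set (Set Torus) := {X | IsClosed X ∧ IsSmoothOff ω X} with hS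
  have hex : ∀ X : S, ∃ g : Torus → ℂ, (∀ᵐ θ ∂m, θ ∉ (X : Set Torus) → ω θ = g θ) ∧
      ∀ t : ℝ, (t : Torus) ∉ (X : Set Torus) →
        ContDiffAt ℝ (⊤ : ℕ∞) (fun s : ℝ => g (s : Torus)) t := fun X => X.2.2
  choose g hgae hgsm using hex
  -- Two representatives continuous on an open set and equal almost everywhere there agree at every
  -- point, so the local ones glue.
  have heq : ∀ X Y : S, Set.EqOn (g X) (g Y) ((X : Set Torus)ᶜ ∩ (Y : Set Torus)ᶜ) := fun X Y => by
    have hopen : IsOpen ((X : Set Torus)ᶜ ∩ (Y : Set Torus)ᶜ) :=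
      X.2.1.isOpen_compl.inter Y.2.1.isOpen_compl
    refine Measure.eqOn_open_of_ae_eq (μ := m) ?_ hopen
      ((continuousOn_of_smooth (hgsm X)).mono Set.inter_subset_left)
      ((continuousOn_of_smooth (hgsm Y)).mono Set.inter_subset_right)
    rw [Filter.EventuallyEq, ae_restrict_iff' hopen.measurableSet]
    filter_upwards [hgae X, hgae Y] with θ hX hY hθ
    rw [← hX hθ.1, ← hY hθ.2]
  set h : Torus → ℂ := fun θ => if hθ : ∃ X : S, θ ∉ (X : Set Torus) then g hθ.choose θ else 0
  have hh : ∀ X : S, ∀ θ, θ ∉ (X : Set Torus) → h θ = g X θ := fun X θ hθ => by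
    have hθ' : ∃ X : S, θ ∉ (X : Set Torus) := ⟨X, hθ⟩
    simp only [h, dif_pos hθ']
    exact heq _ _ ⟨hθ'.choose_spec, hθ⟩
  have hmem : ∀ θ, θ ∉ singSupp ω → ∃ X : S, θ ∉ (X : Set Torus) := fun θ hθ => by
    simp only [singSupp, Set.mem_sInter, not_forall] at hθ
    obtain ⟨X, hX, hθX⟩ := hθ
    exact ⟨⟨X, hX⟩, hθX⟩
  refine ⟨h, ?_, fun t ht => ?_⟩
  -- By the Lindelöf property countably many of the open sets suffice, so the exceptional null sets
  -- have null union.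
  · obtain ⟨T, hTc, hTS⟩ := TopologicalSpace.isOpen_iUnion_countable
      (fun X : S => (X : Set Torus)ᶜ) fun X => X.2.1.isOpen_compl
    have hae : ∀ᵐ θ ∂m, ∀ X ∈ T, θ ∉ (X : Set Torus) → ω θ = g X θ :=
      (ae_ball_iff hTc).2 fun X _ => hgae X
    filter_upwards [hae] with θ hθ hθs
    obtain ⟨X, hX⟩ := hmem θ hθs
    have : θ ∈ ⋃ X ∈ T, (X : Set Torus)ᶜ := by
      rw [hTS]; exact Set.mem_iUnion.2 ⟨X, hX⟩
    obtain ⟨Y, hYT, hY⟩ := Set.mem_iUnion₂.1 this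
    rw [hθ Y hYT hY, hh Y θ hY]
  · obtain ⟨X, hX⟩ := hmem _ ht
    refine (hgsm X t hX).congr_of_eventuallyEq ?_
    filter_upwards [(X.2.1.isOpen_compl.preimage continuous_coe_torus).mem_nhds hX] with s hs
    exact hh X _ hs

/-- Smooth Urysohn functions on the circle. -/
lemma exists_smooth_cutoff {K₀ K₁ : Set Torus} (h₀ : IsClosed K₀) (h₁ : IsClosed K₁)
    (hd : Disjoint K₀ K₁) : ∃ φ : C(Torus, ℂ), IsSmooth φ ∧ (∀ θ, star (φ θ) = φ θ) ∧
      (∀ θ ∈ K₀, ∀ᶠ θ' in 𝓝 θ, φ θ' = 0) ∧ ∀ θ ∈ K₁, ∀ᶠ θ' in 𝓝 θ, φ θ' = 1 := by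
  have he : Continuous (fourier 1 : C(Torus, ℂ)) := (fourier 1 : C(Torus, ℂ)).continuous
  have hinj : Function.Injective (fourier 1 : C(Torus, ℂ)) := fun x y hxy => by
    rw [fourier_one, fourier_one] at hxy
    exact AddCircle.injective_toCircle one_ne_zero (Subtype.ext hxy)
  -- The cutoff is built in the plane and pulled back along the smooth embedding `θ ↦ exp (2πiθ)`.
  obtain ⟨f, hf0, hf1, -⟩ := exists_contMDiffMap_zero_one_nhds_of_isClosed (n := ⊤)
    (modelWithCornersSelf ℝ ℂ) (h₀.isCompact.image he).isClosed (h₁.isCompact.image he).isClosed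
    (Set.disjoint_image_of_injective hinj hd)
  have hf : ContDiff ℝ (⊤ : ℕ∞) f := f.contMDiff.contDiff
  refine ⟨⟨fun θ => ((f (fourier 1 θ) : ℝ) : ℂ),
    Complex.continuous_ofReal.comp (hf.continuous.comp he)⟩, ?_, fun θ => ?_, fun θ hθ => ?_,
    fun θ hθ => ?_⟩
  · have h1 : ContDiff ℝ (⊤ : ℕ∞) fun s : ℝ => (fourier 1 (s : Torus) : ℂ) := by
      simp only [fourier_coe_apply]
      exact Complex.contDiff_exp.comp (by
        have : ContDiff ℝ (⊤ : ℕ∞) fun s : ℝ => (s : ℂ) := Complex.ofRealCLM.contDiff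
        fun_prop)
    exact Complex.ofRealCLM.contDiff.comp (hf.comp h1)
  · exact Complex.conj_ofReal _
  · have := he.continuousAt.eventually (eventually_nhdsSet_iff_forall.1 hf0 _ ⟨θ, hθ, rfl⟩)
    filter_upwards [this] with θ' h
    simp only [ContinuousMap.coe_mk, h, Complex.ofReal_zero]
  · have := he.continuousAt.eventually (eventually_nhdsSet_iff_forall.1 hf1 _ ⟨θ, hθ, rfl⟩)
    filter_upwards [this] with θ' h
    simp only [ContinuousMap.coe_mk, h, Complex.ofReal_one]

/-- A smooth function that vanishes near the singular support of `ω` turns it into a smooth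
symbol. -/
lemma exists_smooth_mul {φ : C(Torus, ℂ)} (hφ : IsSmooth φ) {ω : LInfty}
    (h : ∀ θ ∈ singSupp ω, ∀ᶠ θ' in 𝓝 θ, φ θ' = 0) :
    ∃ s : C(Torus, ℂ), IsSmooth s ∧ mulCont φ ∘L mulOp ω = mulCont s := by
  obtain ⟨g, hgae, hgsm⟩ := isSmoothOff_singSupp ω
  have hsm : ContDiff ℝ (⊤ : ℕ∞) fun s : ℝ => φ (s : Torus) * g (s : Torus) := by
    refine contDiff_iff_contDiffAt.2 fun t => ?_
    by_cases ht : (t : Torus) ∈ singSupp ω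
    · refine (contDiffAt_const (c := (0 : ℂ))).congr_of_eventuallyEq ?_
      filter_upwards [continuous_coe_torus.continuousAt.eventually (h _ ht)] with s hs
      rw [hs, zero_mul]
    · exact (ContDiff.contDiffAt hφ).mul (hgsm t ht)
  have hcont : Continuous fun θ => φ θ * g θ := continuous_iff_continuousAt.2 fun θ => by
    obtain ⟨t, rfl⟩ := QuotientAddGroup.mk_surjective θ
    exact continuousAt_of_lift (g := fun θ => φ θ * g θ) hsm.continuous.continuousAt
  refine ⟨⟨fun θ => φ θ * g θ, hcont⟩, hsm, ?_⟩
  · ext1 f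
    apply Lp.ext
    rw [ContinuousLinearMap.comp_apply]
    filter_upwards [coeFn_mulCont φ (mulOp ω f), coeFn_mulOp ω f,
      coeFn_mulCont ⟨fun θ => φ θ * g θ, hcont⟩ f, hgae] with θ h1 h2 h3 h4
    rw [h1, h2, h3]
    simp only [ContinuousMap.coe_mk]
    by_cases hθ : θ ∈ singSupp ω
    · simp [(h θ hθ).self_of_nhds]
    · rw [h4 hθ]; ring

/-- The cutoff `φ` is `0` near the singular support of `ω₂` and `1` near that of `ω₁`, so `φ ω₂` and
`(1 - φ) ω₁` are both smooth. -/
lemma rapid_hankel_of_disjoint {ω₁ ω₂ : LInfty} (h : singSupp ω₁ ∩ singSupp ω₂ = ∅) :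
    Rapid ((hankel ω₁).adjoint ∘L hankel ω₂) ∧ Rapid (hankel ω₁ ∘L (hankel ω₂).adjoint) := by
  obtain ⟨φ, hφ, hφr, hφ0, hφ1⟩ := exists_smooth_cutoff (isClosed_singSupp ω₂)
    (isClosed_singSupp ω₁) (Set.disjoint_iff_inter_eq_empty.2 (by rwa [Set.inter_comm]))
  obtain ⟨s₂, hs₂, h₂⟩ := exists_smooth_mul hφ hφ0
  have hφ' : IsSmooth (1 - φ) := by
    have : ContDiff ℝ (⊤ : ℕ∞) fun s : ℝ => 1 - φ (s : Torus) := contDiff_const.sub hφ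
    exact this
  obtain ⟨s₁, hs₁, h₁⟩ := exists_smooth_mul (ω := ω₁) hφ' fun θ hθ => by
    filter_upwards [hφ1 θ hθ] with θ' h
    simp [h]
  have hone : mulCont (1 : C(Torus, ℂ)) = ContinuousLinearMap.id ℂ L2 := by
    ext1 f
    apply Lp.ext
    filter_upwards [coeFn_mulCont 1 f] with θ hθ
    simpa using hθ
  have hB₁ : mulOp ω₁ = mulCont φ ∘L mulOp ω₁ + mulCont s₁ := by
    rw [← h₁, map_sub, hone]
    ext1 f
    simp
  exact ⟨rapid_adjoint_comp hφ hφr hs₁ hs₂ hB₁ h₂, rapid_comp_adjoint hφ hφr hs₁ hs₂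
    (mulOp_mulCont_comm ω₁ φ) (mulOp_mulCont_comm ω₂ φ) hB₁ h₂⟩

lemma hankel_sum {ι : Type*} [Fintype ι] (ω : ι → LInfty) :
    hankel (∑ l, ω l) = ∑ l, hankel (ω l) := by
  have h : mulOp (∑ l, ω l) = ∑ l, mulOp (ω l) := map_sum _ _ _
  ext1 f
  simp only [hankel, h, ContinuousLinearMap.comp_apply, sum_apply, map_sum]

end SingularSupport

end HankelLocalization

end

/-! ### The localization theorem -/

open HankelLocalization in
theorem theorem1p1 (L : ℕ) (ω : Fin L → LInfty)
    (hω : ∀ j l : Fin L, j ≠ l → singSupp (ω j) ∩ singSupp (ω l) = ∅)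
    (p : ℝ) (hp : 0 < p) :
    limsup (scaledSingularValue p (hankel (∑ l, ω l))) atTop
        ≤ ∑ l, limsup (scaledSingularValue p (hankel (ω l))) atTop ∧
    ∑ l, liminf (scaledSingularValue p (hankel (ω l))) atTop
        ≤ liminf (scaledSingularValue p (hankel (∑ l, ω l))) atTop ∧
    ∀ c : Fin L → ℝ≥0∞,
      (∀ l, Tendsto (scaledSingularValue p (hankel (ω l))) atTop (𝓝 (c l))) →
        Tendsto (scaledSingularValue p (hankel (∑ l, ω l))) atTop (𝓝 (∑ l, c l)) := by
  have hR : ∀ j l, j ≠ l → _ := fun j l hjl => rapid_hankel_of_disjoint (hω j l hjl)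
  obtain ⟨hsup, hinf⟩ := limsup_liminf_sum_of_rapid (A := fun l => hankel (ω l))
    (fun j l hjl => (hR j l hjl).1) (fun j l hjl => (hR j l hjl).2) hp
  rw [hankel_sum]
  refine ⟨hsup, hinf, fun c hc => tendsto_of_le_liminf_of_limsup_le ?_ ?_⟩
  · simpa only [(hc _).liminf_eq] using hinf
  · simpa only [(hc _).limsup_eq] using hsup
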